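/- Setting. Let $U=\{1,\dots,u\}$ with $u\ge 1$, and let public weights $w\in(0,1]^U$ be given. For $A\subseteq U$ let $x_A\in\{0,1\}^U$ be its characteristic vector and $w_A=(w_j\mathbf 1[j\in A])_j$. For $n\ge 1$ draw independently a uniformly random function $h:U\to\{1,\dots,n\}$ and a fully random function $s:U\to[0,1]$ (independent uniform values). Let $H=H(h,s)$ be the matrix over $\mathrm{GF}(2)$ with rows indexed by $(i,k)$, $0\le i<\lceil\log_2 u\rceil$, $1\le k\le n$, whose entry in column $j$ is $1$ iff $h(j)=k$ and $s(j)\in(w_j/2^{i+1},w_j/2^i]$. Let $\mathcal N_\varepsilon$ be the law of a vector in $\mathrm{GF}(2)^{n\lceil\log_2u\rceil}$ with independent entries, each equal to $1$ with probability $1/(2+\varepsilon)$. The noisy KOR sketch of $A$ with privacy parameter $\varepsilon>0$ is $Hx_A+\varphi$ with $\varphi\sim\mathcal N_\varepsilon$ independent of $H$. Put $\varepsilon'=\varepsilon^2/(2+2\varepsilon)$. Estimator. For $\gamma>0$ and a sketch $z$, let $Z_i$ be the number of ones of $z$ at level $i$. Let $I_i=[0,u]$ if $Z_i\ge(1-\gamma)n/2$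 and otherwise $$I_i=\Big[2^in\ln\frac{(2/\varepsilon'+1)^{-1}}{1-\frac{2Z_i}{(1+\gamma)n}},\ 2^in\ln\frac{(2/\varepsilon'+1)^{-1}}{1-\frac{2Z_i}{(1-\gamma)n}}\Big].$$ Let $I=\bigcap_iI_i$ and $\eta=\dfrac{6\gamma(e^3(2/\varepsilon'+1)-1)}{1+\gamma-2\gamma e^3(2/\varepsilon'+1)}$. The estimate $\hat\Delta(z)$ is $\min I$ if $I\neq\emptyset$ and $\max I\le(1+\eta)\min I$, and $0$ otherwise. Claim. 1. For every $u$, $n$, $w$, every $\varepsilon>0$ and every fixed $h,s$, the mechanism $A\mapsto Hx_A+\varphi$, $\varphi\sim\mathcal N_\varepsilon$, is $\varepsilon$-differentially private (neighbouring sets: one contains the other and the sizes differ by $1$). 2. For all $A,B\subseteq U$ and all $\varphi,\psi$ we have $(Hx_A+\varphi)+(Hx_B+\psi)=Hx_{A\triangle B}+(\varphi+\psi)$ over $\mathrm{GF}(2)$, and if $\varphi,\psi\sim\mathcal N_\varepsilon$ are independent, then $\varphi+\psi\sim\mathcal N_{\varepsilon'}$. So the sum of two noisy KOR sketches built with the same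 $H$ is a noisy KOR sketch of $A\triangle B$ with privacy parameter $\varepsilon'$. 3. For every $E$ there is a real polynomial $P$ in three variables such that for all $u\ge1$, $0<\varepsilon\le E$ and $\beta>0$ there are $n\ge1$ and $\gamma$ with $0<\gamma<\frac{\beta-1/n}{7e^3(2/\varepsilon'+1)}$ and sketch size $n\lceil\log_2u\rceil\le P(1/\varepsilon,1/\beta,\ln u)$ for which the following holds for all $w\in(0,1]^U$ and all $A,B\subseteq U$. If $h,s$ and $\varphi,\psi\sim\mathcal N_\varepsilon$ are independent, then with probability at least $1-1/u$ the estimate $\hat\Delta=\hat\Delta\big((Hx_A+\varphi)+(Hx_B+\psi)\big)$ satisfies $$\big|\,\|w_{A\triangle B}\|_1-\hat\Delta\,\big|<\beta\,\|w_{A\triangle B}\|_1+P(1/\varepsilon,1/\beta,\ln u).$$ -/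

import Mathlib

open MeasureTheory
open scoped symmDiff

noncomputable section

namespace KOR

/-! ### Differential privacy -/

/-- Two sets are neighbouring if one is contained in the other and their sizes differ by one. -/
def Neighboring {u : ℕ} (S T : Finset (Fin u)) : Prop :=
  (S ⊆ T ∧ T.card = S.card + 1) ∨ (T ⊆ S ∧ S.card = T.card + 1)

/-- A randomized mechanism on subsets of the universe, given by the law `M S` of its output on
input `S`, is (purely) `ε`-differentially private. -/
def DifferentiallyPrivate {u : ℕ} {Y : Type} [MeasurableSpace Y] (ε : ℝ)
    (M : Finset (Fin u) → Measure Y) : Prop :=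
  ∀ S T : Finset (Fin u), Neighboring S T →
    ∀ R : Set Y, M S R ≤ ENNReal.ofReal (Real.exp ε) * M T R

/-! ### Sets, characteristic vectors and weights -/

/-- The characteristic vector of `A`, over GF(2). -/
def charVec {u : ℕ} (A : Finset (Fin u)) : Fin u → ZMod 2 :=
  fun j => if j ∈ A then 1 else 0

/-- The weight vector of `A`: the weights `w` restricted to `A`. -/
def weightVec {u : ℕ} (w : Fin u → ℝ) (A : Finset (Fin u)) : Fin u → ℝ :=
  fun j => if j ∈ A then w j else 0

/-- The `1`-norm of a real vector. -/
def l1norm {u : ℕ} (v : Fin u → ℝ) : ℝ := ∑ j, |v j|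

/-! ### The linear sketch over GF(2) -/

/-- The number of levels, `log₂ u` (rounded up when `u` is not a power of two). -/
def levels (u : ℕ) : ℕ := Nat.clog 2 u

/-- Sketches: `n` bits for each level. -/
abbrev Sketch (u n : ℕ) : Type := Fin (levels u) × Fin n → ZMod 2

/-- The matrix of the hash function `h`: its `(k, j)` entry is one iff `h j = k`. -/
def hashMatrix {u n : ℕ} (h : Fin u → Fin n) : Matrix (Fin n) (Fin u) (ZMod 2) :=
  Matrix.of fun k j => if h j = k then 1 else 0

open Classical in
/-- The diagonal matrix of the subsampling at level `i`: element `j` is kept iff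
`s j` lies in `(w j / 2 ^ (i + 1), w j / 2 ^ i]`. -/
def sampleMatrix {u : ℕ} (w : Fin u → ℝ) (s : Fin u → unitInterval) (i : ℕ) :
    Matrix (Fin u) (Fin u) (ZMod 2) :=
  Matrix.diagonal fun j =>
    if (s j : ℝ) ∈ Set.Ioc (w j / 2 ^ (i + 1)) (w j / 2 ^ i) then 1 else 0

/-- The level-`i` sketching matrix. -/
def levelMatrix {u n : ℕ} (w : Fin u → ℝ) (h : Fin u → Fin n) (s : Fin u → unitInterval)
    (i : ℕ) : Matrix (Fin n) (Fin u) (ZMod 2) :=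
  hashMatrix h * sampleMatrix w s i

/-- The sketching matrix: the level matrices for `i = 0, …, log u - 1`, stacked. -/
def sketchMatrix {u n : ℕ} (w : Fin u → ℝ) (h : Fin u → Fin n) (s : Fin u → unitInterval) :
    Matrix (Fin (levels u) × Fin n) (Fin u) (ZMod 2) :=
  Matrix.of fun ik j => levelMatrix w h s ik.1 ik.2 j

/-- The noisy sketch of `A` with perturbation vector `φ`. -/
def noisySketch {u n : ℕ} (w : Fin u → ℝ) (h : Fin u → Fin n) (s : Fin u → unitInterval)
    (A : Finset (Fin u)) (φ : Sketch u n) : Sketch u n :=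
  (sketchMatrix w h s).mulVec (charVec A) + φ

/-! ### The random choices -/

/-- The law of the pair of hash functions `(h, s)` that determines the sketching matrix:
independent, `h` uniform among all functions from the universe to `n` buckets, and `s` a fully
random function from the universe to `[0, 1]`. -/
def hashLaw (u n : ℕ) : Measure ((Fin u → Fin n) × (Fin u → unitInterval)) :=
  (ProbabilityTheory.uniformOn Set.univ).prod (Measure.pi fun _ => volume)

/-- The law of a bit that is one with probability `p`. -/
def bitLaw (p : ℝ) : Measure (ZMod 2) :=
  ENNReal.ofReal (1 - p) • Measure.dirac 0 + ENNReal.ofReal p • Measure.dirac 1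

/-- The law of the perturbation vector with privacy parameter `ε`: the entries are independent,
each of them equal to one with probability `1 / (2 + ε)`. -/
def noiseLaw (u n : ℕ) (ε : ℝ) : Measure (Sketch u n) :=
  Measure.pi fun _ => bitLaw (1 / (2 + ε))

/-- The law of the noisy sketch of `A` over the choice of the noise, for fixed `h` and `s`. -/
def noisySketchLaw {u n : ℕ} (w : Fin u → ℝ) (h : Fin u → Fin n) (s : Fin u → unitInterval)
    (ε : ℝ) (A : Finset (Fin u)) : Measure (Sketch u n) :=
  (noiseLaw u n ε).map (noisySketch w h s A)

/-- The privacy parameter of the sum of two noisy sketches with privacy parameter `ε`. -/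
def mergedParam (ε : ℝ) : ℝ := ε ^ 2 / (2 + 2 * ε)

/-! ### Estimation from a noisy sketch -/

/-- The number of ones at level `i` of a sketch. -/
def onesCount {u n : ℕ} (z : Sketch u n) (i : Fin (levels u)) : ℕ :=
  (Finset.univ.filter fun k : Fin n => z (i, k) = 1).card

open Classical in
/-- The interval computed from level `i` of a noisy sketch with privacy parameter `ε`. -/
def levelInterval {u n : ℕ} (ε γ : ℝ) (z : Sketch u n) (i : Fin (levels u)) : Set ℝ :=
  if (1 - γ) * n / 2 ≤ (onesCount z i : ℝ) then Set.Icc 0 (u : ℝ)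
  else Set.Icc
    (2 ^ (i : ℕ) * n *
      Real.log ((1 / (2 / ε + 1)) / (1 - 2 * onesCount z i / ((1 + γ) * n))))
    (2 ^ (i : ℕ) * n *
      Real.log ((1 / (2 / ε + 1)) / (1 - 2 * onesCount z i / ((1 - γ) * n))))

/-- The intersection of the intervals of all levels. -/
def estimateInterval {u n : ℕ} (ε γ : ℝ) (z : Sketch u n) : Set ℝ :=
  ⋂ i : Fin (levels u), levelInterval ε γ z i

/-- The tolerance for the ratio of the endpoints of the intersection. -/
def ratioTolerance (ε γ : ℝ) : ℝ :=
  6 * γ * (Real.exp 3 * (2 / ε + 1) - 1) / (1 + γ - 2 * γ * (Real.exp 3 * (2 / ε + 1)))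

open Classical in
/-- The estimate of the weight computed from a noisy sketch with privacy parameter `ε`: the
minimum of the intersection of the intervals if the maximum is within the prescribed factor of
the minimum, and `0` otherwise. -/
def estimate {u n : ℕ} (ε γ : ℝ) (z : Sketch u n) : ℝ :=
  if (estimateInterval ε γ z).Nonempty ∧
      sSup (estimateInterval ε γ z) ≤
        (1 + ratioTolerance ε γ) * sInf (estimateInterval ε γ z)
  then sInf (estimateInterval ε γ z) else 0

end KOR

end

noncomputable section

namespace KOR

/-! ### Noise -/

/-! Privacy. The sampling intervals of one element on different levels are disjoint and `h` picks
one bucket, so every column of the sketching matrix has at most one nonzero entry. Neighbouring sets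
therefore need noise vectors that differ in at most one bit, and the two values of a noise bit have
probabilities in the ratio `1 + ε ≤ exp ε`.

Merging. Linearity over GF(2) gives the sketch of the symmetric difference. With `p = 1 / (2 + ε)`,
the sum of two noise bits is one with probability `2 * p * (1 - p)`, which is `1 / (2 + mergedParam
ε)`.

Accuracy. On one level, pass from bits to signs and follow the sum `g` of the `n` signs. Start from
the noise and throw in the elements one by one: with probability `q` an element flips a uniformly
random bit, which multiplies the mean of `g` by `1 - 2 * q / n`. This contraction also controls
exponential moments (`one_flip_moment_real`, iterated in `flips_moment`), so the dependence between
buckets never has to be analysed. Together with the independent noise bits (`noise_moment`) this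
yields a sub-Gaussian bound with variance of order `n` (`mergedSketch_moment`), hence concentration
on all levels at once (`all_levels_close`).

With `W` the weight of the symmetric difference, the mean on level `i` is close to `n * exp (-W / (2
^ i * n)) / (2 / ε' + 1)` (`meanSign_bounds`). Inverting this formula puts `W` into every interval
(`mem_levelInterval`). If `W ≥ n`, some level has `W / (2 ^ i * n)` of constant size, and there the
interval is narrow (`levelInterval_ratio`), so the estimate is accepted. An accepted estimate has
relative error at most the tolerance; a rejection is possible only for `W < n`, where the answer `0`
costs less than `n` (`estimate_error`). It remains to choose `γ` and `n` polynomially. -/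

lemma zmod_two_cases (b : ZMod 2) : b = 0 ∨ b = 1 := by
  fin_cases b
  · exact Or.inl rfl
  · exact Or.inr rfl

lemma bitLaw_apply (p : ℝ) (b : ZMod 2) :
    bitLaw p {b} = ENNReal.ofReal (if b = 1 then p else 1 - p) := by
  rcases zmod_two_cases b with rfl | rfl <;> simp [bitLaw]

lemma isProbabilityMeasure_bitLaw {p : ℝ} (h0 : 0 ≤ p) (h1 : p ≤ 1) :
    IsProbabilityMeasure (bitLaw p) := by
  constructor
  simp only [bitLaw, Measure.add_apply, Measure.smul_apply, measure_univ, smul_eq_mul, mul_one]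
  rw [← ENNReal.ofReal_add (by linarith) h0]
  simp

instance sigmaFinite_bitLaw (p : ℝ) : SigmaFinite (bitLaw p) := by
  unfold bitLaw
  have : IsFiniteMeasure (ENNReal.ofReal (1 - p) • Measure.dirac (0 : ZMod 2) +
      ENNReal.ofReal p • Measure.dirac 1) := by
    constructor
    simp
  infer_instance

lemma bit_prob_bounds {ε : ℝ} (hε : 0 < ε) : 0 < 1 / (2 + ε) ∧ 1 / (2 + ε) ≤ 1 / 2 :=
  ⟨by positivity, one_div_le_one_div_of_le (by norm_num) (by linarith)⟩

lemma isProbabilityMeasure_noiseLaw (u n : ℕ) {ε : ℝ} (hε : 0 < ε) :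
    IsProbabilityMeasure (noiseLaw u n ε) := by
  have := isProbabilityMeasure_bitLaw (bit_prob_bounds hε).1.le
    ((bit_prob_bounds hε).2.trans (by norm_num))
  unfold noiseLaw
  infer_instance

lemma noiseLaw_singleton (u n : ℕ) (ε : ℝ) (φ : Sketch u n) :
    noiseLaw u n ε {φ} = ∏ x, bitLaw (1 / (2 + ε)) {φ x} := by
  rw [noiseLaw, Measure.pi_singleton]

/-- The likelier value has probability `1 - p = (1 + ε) * p`, where `p = 1 / (2 + ε)`, and `1 + ε ≤
exp ε`. -/
lemma bitLaw_le_one {ε : ℝ} (hε : 0 < ε) (a b : ZMod 2) :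
    bitLaw (1 / (2 + ε)) {a} ≤ ENNReal.ofReal (Real.exp ε) * bitLaw (1 / (2 + ε)) {b} := by
  obtain ⟨h0, h1⟩ := bit_prob_bounds hε
  have hE : 1 + ε ≤ Real.exp ε := by linarith [Real.add_one_le_exp ε]
  rw [bitLaw_apply, bitLaw_apply, ← ENNReal.ofReal_mul (Real.exp_pos _).le]
  apply ENNReal.ofReal_le_ofReal
  have key : 1 - 1 / (2 + ε) = (1 + ε) * (1 / (2 + ε)) := by field_simp; ring
  have h2 : (1 + ε) * (1 / (2 + ε)) ≤ Real.exp ε * (1 / (2 + ε)) := by gcongr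
  have h3 : 1 * (1 - 1 / (2 + ε)) ≤ Real.exp ε * (1 - 1 / (2 + ε)) := by
    apply mul_le_mul_of_nonneg_right _ (by linarith)
    linarith
  split_ifs <;> linarith

/-- Changing at most one noise bit changes the probability by a factor of at most `exp ε`. -/
lemma noiseLaw_singleton_le (u n : ℕ) {ε : ℝ} (hε : 0 < ε) (φ ψ : Sketch u n)
    (h : ∃ x₀, ∀ x, x ≠ x₀ → φ x = ψ x) :
    noiseLaw u n ε {φ} ≤ ENNReal.ofReal (Real.exp ε) * noiseLaw u n ε {ψ} := by
  classical
  obtain ⟨x₀, hx⟩ := h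
  rw [noiseLaw_singleton, noiseLaw_singleton, ← Finset.mul_prod_erase _ _ (Finset.mem_univ x₀),
    ← Finset.mul_prod_erase _ (fun x => bitLaw (1 / (2 + ε)) {ψ x}) (Finset.mem_univ x₀), ← mul_assoc]
  have : ∏ x ∈ Finset.univ.erase x₀, bitLaw (1 / (2 + ε)) {φ x} =
      ∏ x ∈ Finset.univ.erase x₀, bitLaw (1 / (2 + ε)) {ψ x} :=
    Finset.prod_congr rfl fun x hx' => by rw [hx x (Finset.ne_of_mem_erase hx')]
  rw [this]
  gcongr
  exact bitLaw_le_one hε _ _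

lemma noiseLaw_singleton_le_of_diff (u n : ℕ) {ε : ℝ} (hε : 0 < ε) (φ ψ : Sketch u n)
    (h : ∀ x y, φ x ≠ ψ x → φ y ≠ ψ y → x = y) :
    noiseLaw u n ε {φ} ≤ ENNReal.ofReal (Real.exp ε) * noiseLaw u n ε {ψ} := by
  by_cases hne : ∃ x, φ x ≠ ψ x
  · obtain ⟨x₀, hx₀⟩ := hne
    refine noiseLaw_singleton_le u n hε φ ψ ⟨x₀, fun x hx => ?_⟩
    by_contra hc
    exact hx (h x x₀ hc hx₀)
  · push Not at hne
    have : φ = ψ := funext hne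
    subst this
    calc noiseLaw u n ε {φ} = 1 * noiseLaw u n ε {φ} := (one_mul _).symm
      _ ≤ _ := by
        gcongr
        rw [← ENNReal.ofReal_one]
        exact ENNReal.ofReal_le_ofReal (by linarith [Real.add_one_le_exp ε])

/-! ### Linearity -/

lemma zmod_two_add_self (a : ZMod 2) : a + a = 0 := CharTwo.add_self_eq_zero a

lemma charVec_symmDiff {u : ℕ} (A B : Finset (Fin u)) :
    charVec (A ∆ B) = charVec A + charVec B := by
  funext j
  by_cases hA : j ∈ A <;> by_cases hB : j ∈ B <;>
    simp [charVec, Finset.mem_symmDiff, hA, hB, zmod_two_add_self]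

lemma noisySketch_add {u n : ℕ} (w : Fin u → ℝ) (h : Fin u → Fin n) (s : Fin u → unitInterval)
    (A B : Finset (Fin u)) (φ ψ : Sketch u n) :
    noisySketch w h s A φ + noisySketch w h s B ψ = noisySketch w h s (A ∆ B) (φ + ψ) := by
  simp only [noisySketch, charVec_symmDiff, Matrix.mulVec_add]
  abel

open Classical in
lemma sketchMatrix_apply {u n : ℕ} (w : Fin u → ℝ) (h : Fin u → Fin n)
    (s : Fin u → unitInterval) (i : Fin (levels u)) (k : Fin n) (j : Fin u) :
    sketchMatrix w h s (i, k) j =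
      if h j = k ∧ (s j : ℝ) ∈ Set.Ioc (w j / 2 ^ ((i : ℕ) + 1)) (w j / 2 ^ (i : ℕ))
      then 1 else 0 := by
  simp only [sketchMatrix, levelMatrix, hashMatrix, sampleMatrix, Matrix.of_apply,
    Matrix.mul_diagonal]
  split_ifs <;> simp_all

/-! ### Privacy -/

lemma sample_level_unique {a x : ℝ} (ha : 0 < a) {i i' : ℕ}
    (h : x ∈ Set.Ioc (a / 2 ^ (i + 1)) (a / 2 ^ i))
    (h' : x ∈ Set.Ioc (a / 2 ^ (i' + 1)) (a / 2 ^ i')) : i = i' := by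
  have key : ∀ m l : ℕ, x ∈ Set.Ioc (a / 2 ^ (m + 1)) (a / 2 ^ m) →
      x ∈ Set.Ioc (a / 2 ^ (l + 1)) (a / 2 ^ l) → ¬ m < l := by
    intro m l hm hl hml
    have : a / 2 ^ l ≤ a / (2 : ℝ) ^ (m + 1) := by
      gcongr
      · norm_num
      · exact hml
    linarith [hm.1, hl.2]
  have h1 := key i i' h h'
  have h2 := key i' i h' h
  omega

/-- The level of a nonzero entry is forced by disjointness of the sampling intervals (here `w j > 0`
matters), and its bucket by `h`. This is the sensitivity bound behind privacy. -/
lemma sketchMatrix_column {u n : ℕ} {w : Fin u → ℝ} (hw : ∀ j, 0 < w j) (h : Fin u → Fin n)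
    (s : Fin u → unitInterval) (j : Fin u) (x y : Fin (levels u) × Fin n)
    (hx : sketchMatrix w h s x j ≠ 0) (hy : sketchMatrix w h s y j ≠ 0) : x = y := by
  obtain ⟨i, k⟩ := x
  obtain ⟨i', k'⟩ := y
  rw [sketchMatrix_apply] at hx hy
  have hx' := (ite_ne_right_iff.1 hx).1
  have hy' := (ite_ne_right_iff.1 hy).1
  have hi := sample_level_unique (hw j) hx'.2 hy'.2
  rw [Prod.mk.injEq]
  exact ⟨Fin.ext hi, hx'.1.symm.trans hy'.1⟩

lemma charVec_singleton {u : ℕ} (j : Fin u) : charVec {j} = Pi.single j 1 := by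
  funext l
  by_cases hl : l = j
  · subst hl; simp [charVec]
  · simp [charVec, hl]

lemma exists_singleton_of_neighboring {u : ℕ} {S T : Finset (Fin u)} (h : Neighboring S T) :
    ∃ j, S ∆ T = {j} := by
  rcases h with ⟨h1, h2⟩ | ⟨h1, h2⟩
  · rw [symmDiff_of_le h1]
    apply Finset.card_eq_one.1
    rw [Finset.card_sdiff_of_subset h1]
    omega
  · rw [symmDiff_comm, symmDiff_of_le h1]
    apply Finset.card_eq_one.1
    rw [Finset.card_sdiff_of_subset h1]
    omega

lemma noisySketchLaw_apply {u n : ℕ} (w : Fin u → ℝ) (h : Fin u → Fin n)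
    (s : Fin u → unitInterval) (ε : ℝ) (A : Finset (Fin u)) (z : Sketch u n) :
    noisySketchLaw w h s ε A {z} =
      noiseLaw u n ε {z - (sketchMatrix w h s).mulVec (charVec A)} := by
  rw [noisySketchLaw, Measure.map_apply (measurable_of_finite _) (MeasurableSet.singleton z)]
  congr 1
  ext φ
  simp only [noisySketch, Set.mem_preimage, Set.mem_singleton_iff]
  rw [eq_sub_iff_add_eq, add_comm]

/-- A measure on a finite space is dominated by another one if this holds on singletons. -/
lemma measure_le_of_singleton_le {Y : Type*} [Finite Y] [MeasurableSpace Y]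
    [MeasurableSingletonClass Y] {μ ν : Measure Y} {c : ENNReal}
    (h : ∀ y, μ {y} ≤ c * ν {y}) (R : Set Y) : μ R ≤ c * ν R := by
  have hR : R.Finite := Set.toFinite R
  have e : R = ↑hR.toFinset := by simp
  rw [e, ← sum_measure_singleton, ← sum_measure_singleton, Finset.mul_sum]
  exact Finset.sum_le_sum fun y _ => h y

lemma differentiallyPrivate_noisySketchLaw {u n : ℕ} {w : Fin u → ℝ} (hw : ∀ j, 0 < w j)
    {ε : ℝ} (hε : 0 < ε) (h : Fin u → Fin n) (s : Fin u → unitInterval) :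
    DifferentiallyPrivate ε (noisySketchLaw w h s ε) := by
  intro S T hST R
  refine measure_le_of_singleton_le (fun z => ?_) R
  obtain ⟨j, hj⟩ := exists_singleton_of_neighboring hST
  rw [noisySketchLaw_apply, noisySketchLaw_apply]
  -- The noise vectors producing the same output `z` from `S` and from `T` differ by column `j` of
  -- the matrix, where `j` is the one element in which the sets differ.
  have hc : (sketchMatrix w h s).mulVec (charVec S) + (sketchMatrix w h s).mulVec (charVec T) =
      fun x => sketchMatrix w h s x j := by
    rw [← Matrix.mulVec_add, ← charVec_symmDiff, hj, charVec_singleton, Matrix.mulVec_single_one]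
    rfl
  have hd : ∀ x, (z - (sketchMatrix w h s).mulVec (charVec S)) x ≠
      (z - (sketchMatrix w h s).mulVec (charVec T)) x → sketchMatrix w h s x j ≠ 0 := by
    intro x hx h0
    apply hx
    have := congrFun hc x
    rw [h0, Pi.add_apply] at this
    rw [Pi.sub_apply, Pi.sub_apply, CharTwo.add_eq_zero.1 this]
  exact noiseLaw_singleton_le_of_diff u n hε _ _ fun x y hx hy =>
    sketchMatrix_column hw h s j x y (hd x hx) (hd y hy)

/-! ### Sums of independent noise vectors -/

lemma mergedParam_pos {ε : ℝ} (hε : 0 < ε) : 0 < mergedParam ε := by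
  unfold mergedParam
  positivity

lemma map_add_bitLaw {ε : ℝ} (hε : 0 < ε) :
    ((bitLaw (1 / (2 + ε))).prod (bitLaw (1 / (2 + ε)))).map (fun x => x.1 + x.2) =
      bitLaw (1 / (2 + mergedParam ε)) := by
  obtain ⟨h0, h1⟩ := bit_prob_bounds hε
  set p := 1 / (2 + ε) with hp
  -- Probability that exactly one of two independent bits is one.
  have hq : 1 / (2 + mergedParam ε) = 2 * p * (1 - p) := by
    rw [hp, mergedParam]
    field_simp
    ring
  have hq' : 1 - 2 * p * (1 - p) = (1 - p) * (1 - p) + p * p := by ring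
  have key : ((bitLaw p).prod (bitLaw p)).map (fun x => x.1 + x.2) =
      (ENNReal.ofReal (1 - p) * ENNReal.ofReal (1 - p) + ENNReal.ofReal p * ENNReal.ofReal p) •
        Measure.dirac 0 + (ENNReal.ofReal (1 - p) * ENNReal.ofReal p +
          ENNReal.ofReal p * ENNReal.ofReal (1 - p)) • Measure.dirac 1 := by
    have hm : Measurable fun x : ZMod 2 × ZMod 2 => x.1 + x.2 := measurable_of_finite _
    have h11 : (1 + 1 : ZMod 2) = 0 := rfl
    have hd : ∀ a b : ZMod 2, (Measure.dirac (a, b)).map (fun x : ZMod 2 × ZMod 2 => x.1 + x.2) =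
        Measure.dirac (a + b) := fun a b => Measure.map_dirac' hm (a, b)
    simp only [bitLaw, Measure.prod_add, Measure.add_prod, Measure.prod_smul_left,
      Measure.prod_smul_right, Measure.dirac_prod_dirac, Measure.map_add _ _ hm, Measure.map_smul,
      hd, smul_add, smul_smul, add_smul, add_zero, zero_add, h11]
    abel
  rw [key, hq]
  unfold bitLaw
  rw [hq', ENNReal.ofReal_add (by nlinarith) (by nlinarith), ENNReal.ofReal_mul (by linarith),
    ENNReal.ofReal_mul (by linarith), ← ENNReal.ofReal_mul (by linarith),
    ← ENNReal.ofReal_mul (by linarith), ← ENNReal.ofReal_mul (by linarith),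
    ← ENNReal.ofReal_mul (by linarith), ← ENNReal.ofReal_add (by nlinarith) (by nlinarith),
    ← ENNReal.ofReal_add (by nlinarith) (by nlinarith)]
  congr 3
  ring

lemma map_add_noiseLaw (u n : ℕ) {ε : ℝ} (hε : 0 < ε) :
    ((noiseLaw u n ε).prod (noiseLaw u n ε)).map (fun φψ => φψ.1 + φψ.2) =
      noiseLaw u n (mergedParam ε) := by
  -- A pair of independent noise vectors is a vector of independent pairs, on which addition acts
  -- coordinatewise; this reduces the claim to single bits.
  have e := (measurePreserving_arrowProdEquivProdArrow (ZMod 2) (ZMod 2)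
    (Fin (levels u) × Fin n) (fun _ => bitLaw (1 / (2 + ε)))
    (fun _ => bitLaw (1 / (2 + ε)))).map_eq
  have := isProbabilityMeasure_bitLaw (bit_prob_bounds (mergedParam_pos hε)).1.le
    ((bit_prob_bounds (mergedParam_pos hε)).2.trans (by norm_num))
  have hs : SigmaFinite (((bitLaw (1 / (2 + ε))).prod (bitLaw (1 / (2 + ε)))).map
      (fun x => x.1 + x.2)) := by
    rw [map_add_bitLaw hε]
    infer_instance
  unfold noiseLaw
  rw [← e, Measure.map_map (measurable_of_finite _) (MeasurableEquiv.measurable _)]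
  have h2 := Measure.pi_map_pi (μ := fun _ : Fin (levels u) × Fin n =>
    (bitLaw (1 / (2 + ε))).prod (bitLaw (1 / (2 + ε)))) (f := fun _ x => x.1 + x.2)
    (hμ := fun _ => hs) (fun _ => (measurable_of_finite _).aemeasurable)
  simp only [map_add_bitLaw hε] at h2
  rw [← h2]
  rfl

/-! ### Signs -/

/-- The sign `(-1) ^ b` of a bit. -/
def bitSign (b : ZMod 2) : ℝ := if b = 1 then -1 else 1

lemma bitSign_eq (b : ZMod 2) : bitSign b = 1 ∨ bitSign b = -1 := by
  unfold bitSign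
  split_ifs <;> simp

lemma bitSign_add_one (b : ZMod 2) : bitSign (b + 1) = -bitSign b := by
  have h11 : (1 + 1 : ZMod 2) = 0 := rfl
  rcases zmod_two_cases b with rfl | rfl <;> simp [bitSign, h11]

/-- The sum of the signs of a bit vector. -/
def signSum {n : ℕ} (z : Fin n → ZMod 2) : ℝ := ∑ k, bitSign (z k)

lemma signSum_add_single {n : ℕ} (z : Fin n → ZMod 2) (k : Fin n) :
    signSum (z + Pi.single k 1) = signSum z - 2 * bitSign (z k) := by
  classical
  unfold signSum
  rw [← Finset.add_sum_erase _ _ (Finset.mem_univ k),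
    ← Finset.add_sum_erase Finset.univ (fun k => bitSign (z k)) (Finset.mem_univ k)]
  have : ∑ l ∈ Finset.univ.erase k, bitSign ((z + Pi.single k 1 : Fin n → ZMod 2) l) =
      ∑ l ∈ Finset.univ.erase k, bitSign (z l) :=
    Finset.sum_congr rfl fun l hl => by simp [Finset.ne_of_mem_erase hl]
  rw [this]
  simp only [Pi.add_apply, Pi.single_eq_same, bitSign_add_one]
  ring

/-! ### Exponential moments -/

lemma exp_le_quadratic {t : ℝ} (ht : |t| ≤ 1) : Real.exp t ≤ 1 + t + t ^ 2 := by
  have := (abs_le.1 (Real.abs_exp_sub_one_sub_id_le ht)).2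
  linarith

/-- One step of the walk of `signSum`: with probability `q` a uniformly random bit is flipped. -/
lemma one_flip_moment_real {n : ℕ} (hn : 0 < n) (z : Fin n → ZMod 2) {q l : ℝ} (hq0 : 0 ≤ q)
    (hl : |l| ≤ 1 / 2) :
    ∑ k : Fin n, (1 / (n : ℝ)) * (q * Real.exp (l * (signSum z - 2 * bitSign (z k))) +
      (1 - q) * Real.exp (l * signSum z)) ≤
    Real.exp (l * (1 - 2 * q / n) * signSum z + 4 * q * l ^ 2) := by
  have hn' : (0 : ℝ) < n := by exact_mod_cast hn
  set g := signSum z with hg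
  have h1 : ∀ k : Fin n, (1 / (n : ℝ)) * (q * Real.exp (l * (g - 2 * bitSign (z k))) +
      (1 - q) * Real.exp (l * g)) ≤
      (1 / (n : ℝ)) * (Real.exp (l * g) * (1 + q * (4 * l ^ 2) - (2 * q * l) * bitSign (z k))) := by
    intro k
    have hb : bitSign (z k) ^ 2 = 1 := by rcases bitSign_eq (z k) with h | h <;> rw [h] <;> norm_num
    -- Flipping bit `k` changes the sum by `-2 * bitSign (z k)`; the bound on `l` keeps the exponent
    -- in the range of the quadratic estimate.
    have ht : |(-2 * l * bitSign (z k))| ≤ 1 := by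
      rw [abs_mul, abs_mul]
      have : |bitSign (z k)| = 1 := by rcases bitSign_eq (z k) with h | h <;> rw [h] <;> norm_num
      rw [this]
      norm_num
      linarith
    have he := exp_le_quadratic ht
    have he2 : (-2 * l * bitSign (z k)) ^ 2 = 4 * l ^ 2 := by
      rw [mul_pow, hb]; ring
    rw [he2] at he
    have hs : Real.exp (l * (g - 2 * bitSign (z k))) =
        Real.exp (l * g) * Real.exp (-2 * l * bitSign (z k)) := by
      rw [← Real.exp_add]; congr 1; ring
    rw [hs]
    have hE := Real.exp_pos (l * g)
    gcongr
    have := mul_le_mul_of_nonneg_left he (mul_nonneg hq0 hE.le)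
    nlinarith
  calc _ ≤ ∑ k : Fin n, (1 / (n : ℝ)) *
        (Real.exp (l * g) * (1 + q * (4 * l ^ 2) - (2 * q * l) * bitSign (z k))) :=
        Finset.sum_le_sum fun k _ => h1 k
    -- Averaging `bitSign (z k)` over the uniform bucket gives `g / n`, which is the source of the
    -- contraction.
    _ = Real.exp (l * g) * (1 + (4 * q * l ^ 2 - 2 * q / n * l * g)) := by
        rw [← Finset.mul_sum, ← Finset.mul_sum, Finset.sum_sub_distrib, ← Finset.mul_sum]
        rw [show ∑ k, bitSign (z k) = g from rfl]
        simp only [Finset.sum_const, Finset.card_univ, Fintype.card_fin, nsmul_eq_mul]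
        field_simp
        ring
    _ ≤ Real.exp (l * g) * Real.exp (4 * q * l ^ 2 - 2 * q / n * l * g) := by
        gcongr
        linarith [Real.add_one_le_exp (4 * q * l ^ 2 - 2 * q / n * l * g)]
    _ = _ := by
        rw [← Real.exp_add]; congr 1; ring

/-- The law of the hash value and the sampling value of one element. -/
abbrev elementLaw (n : ℕ) : Measure (Fin n × unitInterval) :=
  (ProbabilityTheory.uniformOn Set.univ).prod volume

open Classical in
/-- The contribution of an element with hash value `x.1` and sampling value `x.2` to the bits of
a level on which the sampling set is `J`. -/
def contribution {n : ℕ} (J : Set unitInterval) (x : Fin n × unitInterval) : Fin n → ZMod 2 :=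
  if x.2 ∈ J then Pi.single x.1 1 else 0

lemma measurable_contribution {n : ℕ} {J : Set unitInterval} (hJ : MeasurableSet J) :
    Measurable (contribution J : Fin n × unitInterval → _) := by
  unfold contribution
  refine Measurable.ite (measurable_snd hJ) ?_ measurable_const
  exact (measurable_of_finite fun k : Fin n => (Pi.single k 1 : Fin n → ZMod 2)).comp measurable_fst

lemma one_flip_moment {n : ℕ} (hn : 0 < n) (z : Fin n → ZMod 2) {J : Set unitInterval}
    (hJ : MeasurableSet J) {q l : ℝ} (hq0 : 0 ≤ q) (hq1 : q ≤ 1)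
    (hq : volume J = ENNReal.ofReal q) (hl : |l| ≤ 1 / 2) :
    ∫⁻ x, ENNReal.ofReal (Real.exp (l * signSum (z + contribution J x))) ∂(elementLaw n) ≤
      ENNReal.ofReal (Real.exp (l * (1 - 2 * q / n) * signSum z + 4 * q * l ^ 2)) := by
  classical
  have : Nonempty (Fin n) := ⟨⟨0, hn⟩⟩
  have hn' : (0 : ℝ) < n := by exact_mod_cast hn
  have hprob : IsProbabilityMeasure
      (ProbabilityTheory.uniformOn (Set.univ : Set (Fin n))) :=
    ProbabilityTheory.isProbabilityMeasure_uniformOn Set.finite_univ Set.univ_nonempty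
  have hmeas : Measurable fun x : Fin n × unitInterval =>
      ENNReal.ofReal (Real.exp (l * signSum (z + contribution J x))) :=
    (measurable_of_finite fun y : Fin n → ZMod 2 =>
      ENNReal.ofReal (Real.exp (l * signSum (z + y)))).comp (measurable_contribution hJ)
  rw [lintegral_prod _ hmeas.aemeasurable]
  refine le_trans (le_of_eq ?_)
    (ENNReal.ofReal_le_ofReal (one_flip_moment_real hn z hq0 hl))
  have hJc : volume Jᶜ = ENNReal.ofReal (1 - q) := by
    rw [prob_compl_eq_one_sub hJ, hq, ENNReal.ofReal_sub _ hq0, ENNReal.ofReal_one]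
  have hin : ∀ k : Fin n, ∫⁻ y, ENNReal.ofReal
      (Real.exp (l * signSum (z + contribution J (k, y)))) =
      ENNReal.ofReal (q * Real.exp (l * (signSum z - 2 * bitSign (z k))) +
      (1 - q) * Real.exp (l * signSum z)) := by
    intro k
    have e : (fun y => ENNReal.ofReal (Real.exp (l * signSum (z + contribution J (k, y))))) =
        J.piecewise (fun _ => ENNReal.ofReal (Real.exp (l * (signSum z - 2 * bitSign (z k)))))
          (fun _ => ENNReal.ofReal (Real.exp (l * signSum z))) := by
      funext y
      by_cases hy : y ∈ J
      · simp only [Set.piecewise_eq_of_mem _ _ _ hy, contribution, hy, if_true, signSum_add_single]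
      · simp only [Set.piecewise_eq_of_notMem _ _ _ hy, contribution, hy, if_false, add_zero]
    rw [e, lintegral_piecewise hJ, lintegral_const, lintegral_const, Measure.restrict_apply_univ,
      Measure.restrict_apply_univ, hq, hJc, ← ENNReal.ofReal_mul (Real.exp_pos _).le,
      ← ENNReal.ofReal_mul (Real.exp_pos _).le, ← ENNReal.ofReal_add
        (mul_nonneg (Real.exp_pos _).le hq0) (mul_nonneg (Real.exp_pos _).le (by linarith))]
    congr 1
    ring
  simp only [hin]
  rw [lintegral_fintype, ENNReal.ofReal_sum_of_nonneg]
  · refine Finset.sum_congr rfl fun k _ => ?_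
    rw [ProbabilityTheory.uniformOn_univ, Measure.count_singleton, Fintype.card_fin, mul_comm,
      ENNReal.ofReal_mul (by positivity), ENNReal.ofReal_div_of_pos hn', ENNReal.ofReal_one,
      ENNReal.ofReal_natCast]
  · intro k _
    have : 0 ≤ 1 - q := by linarith
    positivity

/-- Exponential moments after throwing the elements into the buckets, with initial bits `z`. -/
lemma flips_moment {ι : Type*} [Fintype ι] {n : ℕ} (hn : 2 ≤ n) (z : Fin n → ZMod 2)
    {J : ι → Set unitInterval} (hJ : ∀ j, MeasurableSet (J j)) {q : ι → ℝ} (hq0 : ∀ j, 0 ≤ q j)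
    (hq1 : ∀ j, q j ≤ 1) (hq : ∀ j, volume (J j) = ENNReal.ofReal (q j)) {l : ℝ}
    (hl : |l| ≤ 1 / 2) :
    ∫⁻ x, ENNReal.ofReal (Real.exp (l * signSum (z + ∑ j, contribution (J j) (x j))))
      ∂(Measure.pi fun _ : ι => elementLaw n) ≤
      ENNReal.ofReal (Real.exp (l * (∏ j, (1 - 2 * q j / n)) * signSum z +
        2 * n * l ^ 2 * (1 - ∏ j, (1 - 2 * q j / n)))) := by
  classical
  have hn0 : 0 < n := by omega
  have hn' : (2 : ℝ) ≤ n := by exact_mod_cast hn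
  have hne : Nonempty (Fin n) := ⟨⟨0, hn0⟩⟩
  have hprob : IsProbabilityMeasure
      (ProbabilityTheory.uniformOn (Set.univ : Set (Fin n))) :=
    ProbabilityTheory.isProbabilityMeasure_uniformOn Set.finite_univ Set.univ_nonempty
  have hmeas : ∀ (S : Finset ι) (l : ℝ), Measurable fun x : ι → Fin n × unitInterval =>
      ENNReal.ofReal (Real.exp (l * signSum (z + ∑ j ∈ S, contribution (J j) (x j)))) := by
    intro S l
    refine (measurable_of_finite fun y : Fin n → ZMod 2 =>
      ENNReal.ofReal (Real.exp (l * signSum (z + y)))).comp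
      (Finset.measurable_sum _ fun j _ =>
        (measurable_contribution (hJ j)).comp (measurable_pi_apply j))
  have hc : ∀ j, 0 ≤ 1 - 2 * q j / n ∧ 1 - 2 * q j / n ≤ 1 := by
    intro j
    have h2 : 2 * q j / n ≤ 1 := by
      rw [div_le_one (by linarith)]
      linarith [hq1 j]
    have h3 : 0 ≤ 2 * q j / n := div_nonneg (by linarith [hq0 j]) (by linarith)
    constructor <;> linarith
  -- The parameter `l` is quantified inside the induction: integrating out one element replaces `l`
  -- by `l * c`, with `c` its contraction factor. The hypothesis `2 ≤ n` ensures `0 ≤ c`, so the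
  -- range of `l` is preserved.
  have key : ∀ (S : Finset ι) (l : ℝ), |l| ≤ 1 / 2 → ∀ x,
      (∫⋯∫⁻_S, (fun x => ENNReal.ofReal (Real.exp (l * signSum
        (z + ∑ j ∈ S, contribution (J j) (x j))))) ∂(fun _ : ι => elementLaw n)) x ≤
      ENNReal.ofReal (Real.exp (l * (∏ j ∈ S, (1 - 2 * q j / n)) * signSum z +
        2 * n * l ^ 2 * (1 - ∏ j ∈ S, (1 - 2 * q j / n)))) := by
    intro S
    induction S using Finset.induction_on with
    | empty => intro l hl x; simp
    | insert i S hi ih =>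
      intro l hl x
      obtain ⟨hc0, hc1⟩ := hc i
      set c := 1 - 2 * q i / n with hcdef
      rw [lmarginal_insert' _ (hmeas _ l) hi]
      have hstep : (fun x : ι → Fin n × unitInterval => ∫⁻ xi, ENNReal.ofReal (Real.exp (l * signSum
          (z + ∑ j ∈ insert i S, contribution (J j) (Function.update x i xi j))))
            ∂(elementLaw n)) ≤
          fun x => ENNReal.ofReal (Real.exp (4 * q i * l ^ 2)) *
            ENNReal.ofReal (Real.exp (l * c * signSum
              (z + ∑ j ∈ S, contribution (J j) (x j)))) := by
        intro x
        have e : ∀ xi, z + ∑ j ∈ insert i S, contribution (J j) (Function.update x i xi j) =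
            (z + ∑ j ∈ S, contribution (J j) (x j)) + contribution (J i) xi := by
          intro xi
          rw [Finset.sum_insert hi, Function.update_self]
          have : ∑ j ∈ S, contribution (J j) (Function.update x i xi j) =
              ∑ j ∈ S, contribution (J j) (x j) :=
            Finset.sum_congr rfl fun j hj => by
              rw [Function.update_of_ne (ne_of_mem_of_not_mem hj hi)]
          rw [this]
          abel
        simp only [e]
        refine (one_flip_moment hn0 _ (hJ i) (hq0 i) (hq1 i) (hq i) hl).trans (le_of_eq ?_)
        rw [← ENNReal.ofReal_mul (Real.exp_pos _).le, ← Real.exp_add]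
        congr 2
        ring
      refine (lmarginal_mono hstep x).trans ?_
      have hconst : (∫⋯∫⁻_S, (fun x => ENNReal.ofReal (Real.exp (4 * q i * l ^ 2)) *
            ENNReal.ofReal (Real.exp (l * c * signSum
              (z + ∑ j ∈ S, contribution (J j) (x j))))) ∂(fun _ : ι => elementLaw n)) x =
          ENNReal.ofReal (Real.exp (4 * q i * l ^ 2)) *
          (∫⋯∫⁻_S, (fun x => ENNReal.ofReal (Real.exp (l * c * signSum
              (z + ∑ j ∈ S, contribution (J j) (x j))))) ∂(fun _ : ι => elementLaw n)) x := by
        simp only [lmarginal]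
        rw [lintegral_const_mul' _ _ ENNReal.ofReal_ne_top]
      have hlc : |l * c| ≤ 1 / 2 := by
        rw [abs_mul, abs_of_nonneg hc0]
        nlinarith [abs_nonneg l]
      rw [hconst]
      refine (mul_le_mul_right (ih (l * c) hlc x) _).trans ?_
      rw [← ENNReal.ofReal_mul (Real.exp_pos _).le, ← Real.exp_add]
      apply ENNReal.ofReal_le_ofReal
      apply Real.exp_le_exp.2
      rw [Finset.prod_insert hi, ← hcdef]
      set p := ∏ j ∈ S, (1 - 2 * q j / n) with hp
      have hp0 : 0 ≤ p := Finset.prod_nonneg fun j _ => (hc j).1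
      have hp1 : p ≤ 1 := Finset.prod_le_one (fun j _ => (hc j).1) fun j _ => (hc j).2
      -- Written through `c`, the variance terms nearly telescope: `(1 - c) + c ^ 2 * (1 - p) ≤ 1 -
      -- c * p`, with slack `c * (1 - c) * (1 - p)`.
      have hqc : 4 * q i = 2 * n * (1 - c) := by
        rw [hcdef]; field_simp; ring
      rw [hqc]
      have : 0 ≤ 2 * n * l ^ 2 * (c * (1 - c) * (1 - p)) := by
        have := mul_nonneg (mul_nonneg hc0 (sub_nonneg.2 hc1)) (sub_nonneg.2 hp1)
        positivity
      nlinarith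
  have x₀ : ι → Fin n × unitInterval := fun _ => (hne.some, 0)
  rw [lintegral_eq_lmarginal_univ x₀]
  exact key Finset.univ l hl x₀

/-- Exponential moments of the sign of one noise bit. -/
lemma bit_moment {ε l : ℝ} (hε : 0 < ε) (hl : |l| ≤ 1) :
    ∫⁻ b, ENNReal.ofReal (Real.exp (l * bitSign b)) ∂(bitLaw (1 / (2 + ε))) ≤
      ENNReal.ofReal (Real.exp (l * (1 / (2 / ε + 1)) + l ^ 2)) := by
  obtain ⟨h0, h1⟩ := bit_prob_bounds hε
  set p := 1 / (2 + ε) with hp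
  -- The mean sign of a noise bit.
  have hτ : 1 / (2 / ε + 1) = 1 - 2 * p := by
    rw [hp]; field_simp; ring
  have hs0 : bitSign 0 = 1 := by simp [bitSign]
  have hs1 : bitSign 1 = -1 := by simp [bitSign]
  unfold bitLaw
  rw [lintegral_add_measure, lintegral_smul_measure, lintegral_smul_measure, lintegral_dirac,
    lintegral_dirac, hs0, hs1, smul_eq_mul, smul_eq_mul, ← ENNReal.ofReal_mul (by linarith),
    ← ENNReal.ofReal_mul h0.le, ← ENNReal.ofReal_add
      (mul_nonneg (by linarith) (Real.exp_pos _).le) (mul_nonneg h0.le (Real.exp_pos _).le), hτ]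
  apply ENNReal.ofReal_le_ofReal
  have e1 := exp_le_quadratic (t := l * 1) (by simpa using hl)
  have e2 := exp_le_quadratic (t := l * -1) (by simpa using hl)
  have e3 := Real.add_one_le_exp (l * (1 - 2 * p) + l ^ 2)
  have e4 := mul_le_mul_of_nonneg_left e1 (by linarith : 0 ≤ 1 - p)
  have e5 := mul_le_mul_of_nonneg_left e2 h0.le
  nlinarith

/-- Exponential moments of the noise on one level. -/
lemma noise_moment (u n : ℕ) {ε l : ℝ} (hε : 0 < ε) (hl : |l| ≤ 1) (i : Fin (levels u)) :
    ∫⁻ ζ, ENNReal.ofReal (Real.exp (l * signSum fun k => ζ (i, k))) ∂(noiseLaw u n ε) ≤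
      ENNReal.ofReal (Real.exp (n * (l * (1 / (2 / ε + 1)) + l ^ 2))) := by
  classical
  have hb := isProbabilityMeasure_bitLaw (bit_prob_bounds hε).1.le
    ((bit_prob_bounds hε).2.trans (by norm_num))
  have hN := isProbabilityMeasure_noiseLaw u n hε
  have hind : ProbabilityTheory.iIndepFun (fun (x : Fin (levels u) × Fin n) (ζ : Sketch u n) =>
      ENNReal.ofReal (Real.exp (l * bitSign (ζ x)))) (noiseLaw u n ε) :=
    ProbabilityTheory.iIndepFun_pi (X := fun _ b => ENNReal.ofReal (Real.exp (l * bitSign b)))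
      fun _ => (measurable_of_finite _).aemeasurable
  have hprod := ProbabilityTheory.lintegral_prod_eq_prod_lintegral_of_indepFun
    (Finset.univ.image fun k : Fin n => (i, k)) _ hind fun _ => measurable_of_finite _
  have hinj : Set.InjOn (fun k : Fin n => (i, k)) (Finset.univ : Finset (Fin n)) :=
    fun a _ b _ h => (Prod.mk.inj h).2
  have e : ∀ ζ : Sketch u n, ENNReal.ofReal (Real.exp (l * signSum fun k => ζ (i, k))) =
      ∏ x ∈ Finset.univ.image fun k : Fin n => (i, k),
        ENNReal.ofReal (Real.exp (l * bitSign (ζ x))) := by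
    intro ζ
    rw [Finset.prod_image hinj, ← ENNReal.ofReal_prod_of_nonneg
      (fun _ _ => (Real.exp_pos _).le), ← Real.exp_sum, signSum, Finset.mul_sum]
  simp only [e]
  rw [hprod, Finset.prod_image hinj]
  have hone : ∀ k : Fin n, ∫⁻ ζ : Sketch u n, ENNReal.ofReal (Real.exp (l * bitSign (ζ (i, k))))
      ∂(noiseLaw u n ε) ≤ ENNReal.ofReal (Real.exp (l * (1 / (2 / ε + 1)) + l ^ 2)) := by
    intro k
    have hm := measurePreserving_eval
      (fun _ : Fin (levels u) × Fin n => bitLaw (1 / (2 + ε))) (i, k)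
    have := hm.lintegral_comp (f := fun b => ENNReal.ofReal (Real.exp (l * bitSign b)))
      (measurable_of_finite _)
    unfold noiseLaw
    rw [this]
    exact bit_moment hε hl
  refine (Finset.prod_le_prod' fun k _ => hone k).trans (le_of_eq ?_)
  rw [Finset.prod_const, Finset.card_univ, Fintype.card_fin,
    ← ENNReal.ofReal_pow (Real.exp_pos _).le, ← Real.exp_nat_mul]

/-! ### The levels of a sketch -/

/-- The bits of a sketch on level `i`. -/
def levelBits {u n : ℕ} (z : Sketch u n) (i : Fin (levels u)) : Fin n → ZMod 2 := fun k => z (i, k)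

/-- The sampling values for which element `j` contributes to level `i` of the sketch of `D`. -/
def sampleSet {u : ℕ} (w : Fin u → ℝ) (D : Finset (Fin u)) (i : ℕ) (j : Fin u) :
    Set unitInterval :=
  {x | j ∈ D ∧ (x : ℝ) ∈ Set.Ioc (w j / 2 ^ (i + 1)) (w j / 2 ^ i)}

lemma measurableSet_sampleSet {u : ℕ} (w : Fin u → ℝ) (D : Finset (Fin u)) (i : ℕ) (j : Fin u) :
    MeasurableSet (sampleSet w D i j) :=
  (MeasurableSet.const _).inter (measurable_subtype_coe measurableSet_Ioc)

/-- The interval has length `w j / 2 ^ i - w j / 2 ^ (i + 1)`, and `w j ≤ 1` keeps it inside the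
unit interval. -/
lemma volume_sampleSet {u : ℕ} {w : Fin u → ℝ} (hw : ∀ j, 0 < w j ∧ w j ≤ 1)
    (D : Finset (Fin u)) (i : ℕ) (j : Fin u) :
    volume (sampleSet w D i j) = ENNReal.ofReal (weightVec w D j / 2 ^ (i + 1)) := by
  by_cases hj : j ∈ D
  · have hle : ∀ m : ℕ, w j / 2 ^ m ∈ Set.Icc (0 : ℝ) 1 := fun m =>
      ⟨div_nonneg (hw j).1.le (by positivity),
        (div_le_one (by positivity)).2 ((hw j).2.trans (one_le_pow₀ (by norm_num)))⟩
    have e : sampleSet w D i j = Set.Ioc (⟨_, hle (i + 1)⟩ : unitInterval) ⟨_, hle i⟩ := by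
      ext x
      simp only [sampleSet, hj, true_and, Set.mem_ofPred_eq, Set.mem_Ioc, ← Subtype.coe_lt_coe,
        ← Subtype.coe_le_coe]
    rw [e, unitInterval.volume_Ioc]
    congr 1
    simp only [weightVec, hj, if_true]
    rw [pow_succ]
    field_simp
    ring
  · have e : sampleSet w D i j = ∅ := by
      ext x
      simp [sampleSet, hj]
    simp [e, weightVec, hj]

/-- This turns the matrix product into the process of throwing independent elements onto initial
bits given by the noise. -/
lemma levelBits_noisySketch {u n : ℕ} (w : Fin u → ℝ) (h : Fin u → Fin n)
    (s : Fin u → unitInterval) (D : Finset (Fin u)) (ζ : Sketch u n) (i : Fin (levels u)) :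
    levelBits (noisySketch w h s D ζ) i =
      levelBits ζ i + ∑ j, contribution (sampleSet w D i j) (h j, s j) := by
  funext k
  simp only [levelBits, noisySketch, Pi.add_apply, Matrix.mulVec, dotProduct, Finset.sum_apply]
  rw [add_comm]
  congr 1
  refine Finset.sum_congr rfl fun j _ => ?_
  rw [sketchMatrix_apply]
  by_cases hD : j ∈ D
  · by_cases hs : (s j : ℝ) ∈ Set.Ioc (w j / 2 ^ ((i : ℕ) + 1)) (w j / 2 ^ (i : ℕ))
    · have hm : s j ∈ sampleSet w D i j := ⟨hD, hs⟩
      simp only [charVec, contribution, hD, hs, hm, and_true, if_true, mul_one, Pi.single_apply,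
        eq_comm]
    · have hm : s j ∉ sampleSet w D i j := fun h => hs h.2
      simp only [contribution, hs, hm, and_false, if_false, zero_mul, Pi.zero_apply]
  · have hm : s j ∉ sampleSet w D i j := fun h => hD h.1
    simp only [charVec, contribution, hD, hm, if_false, mul_zero, Pi.zero_apply]

lemma signSum_levelBits {u n : ℕ} (z : Sketch u n) (i : Fin (levels u)) :
    signSum (levelBits z i) = n - 2 * onesCount z i := by
  have h : ∀ k : Fin n, bitSign (z (i, k)) = 1 - 2 * (if z (i, k) = 1 then 1 else 0) := by
    intro k
    unfold bitSign
    split_ifs <;> norm_num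
  simp only [signSum, levelBits, onesCount, h, Finset.sum_sub_distrib, ← Finset.mul_sum,
    Finset.sum_boole, Finset.sum_const, Finset.card_univ, Fintype.card_fin, nsmul_eq_mul, mul_one]

/-! ### The law of the hash functions -/

lemma uniformOn_univ_pi (u n : ℕ) (hn : 0 < n) :
    ProbabilityTheory.uniformOn (Set.univ : Set (Fin u → Fin n)) =
      Measure.pi fun _ => ProbabilityTheory.uniformOn Set.univ := by
  have : Nonempty (Fin n) := ⟨⟨0, hn⟩⟩
  have hprob : IsProbabilityMeasure
      (ProbabilityTheory.uniformOn (Set.univ : Set (Fin n))) :=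
    ProbabilityTheory.isProbabilityMeasure_uniformOn Set.finite_univ Set.univ_nonempty
  refine Measure.ext_of_singleton fun h => ?_
  rw [Measure.pi_singleton]
  simp only [ProbabilityTheory.uniformOn_univ, Measure.count_singleton, Fintype.card_pi,
    Fintype.card_fin, Finset.prod_const, Finset.card_univ, one_div, Nat.cast_pow]
  rw [ENNReal.inv_pow]

lemma isProbabilityMeasure_hashLaw (u n : ℕ) (hn : 0 < n) :
    IsProbabilityMeasure (hashLaw u n) := by
  have : Nonempty (Fin n) := ⟨⟨0, hn⟩⟩
  have hprob : IsProbabilityMeasure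
      (ProbabilityTheory.uniformOn (Set.univ : Set (Fin u → Fin n))) :=
    ProbabilityTheory.isProbabilityMeasure_uniformOn Set.finite_univ Set.univ_nonempty
  unfold hashLaw
  infer_instance

/-- Regroups the randomness by element, so that the elements can be integrated out one at a time. -/
lemma lintegral_hashLaw (u n : ℕ) (hn : 0 < n)
    (f : (Fin u → Fin n) × (Fin u → unitInterval) → ENNReal) :
    ∫⁻ x, f x ∂(hashLaw u n) =
      ∫⁻ x, f (fun j => (x j).1, fun j => (x j).2) ∂(Measure.pi fun _ => elementLaw n) := by
  have : Nonempty (Fin n) := ⟨⟨0, hn⟩⟩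
  have hprob : IsProbabilityMeasure
      (ProbabilityTheory.uniformOn (Set.univ : Set (Fin n))) :=
    ProbabilityTheory.isProbabilityMeasure_uniformOn Set.finite_univ Set.univ_nonempty
  rw [hashLaw, uniformOn_univ_pi u n hn]
  have e := measurePreserving_arrowProdEquivProdArrow (Fin n) unitInterval
    (Fin u) (fun _ => ProbabilityTheory.uniformOn Set.univ) (fun _ => volume)
  exact (e.lintegral_comp_emb (MeasurableEquiv.measurableEmbedding _) f).symm

/-! ### Concentration -/

/-- The joint law of the hash functions and the two noise vectors. -/
abbrev jointLaw (u n : ℕ) (ε : ℝ) :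
    Measure (((Fin u → Fin n) × (Fin u → unitInterval)) × (Sketch u n × Sketch u n)) :=
  (hashLaw u n).prod ((noiseLaw u n ε).prod (noiseLaw u n ε))

/-- The sum of the noisy sketches of `A` and `B`. -/
def mergedSketch {u n : ℕ} (w : Fin u → ℝ) (A B : Finset (Fin u))
    (ω : ((Fin u → Fin n) × (Fin u → unitInterval)) × (Sketch u n × Sketch u n)) : Sketch u n :=
  noisySketch w ω.1.1 ω.1.2 A ω.2.1 + noisySketch w ω.1.1 ω.1.2 B ω.2.2

lemma levelBits_mergedSketch {u n : ℕ} (w : Fin u → ℝ) (A B : Finset (Fin u))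
    (ω : ((Fin u → Fin n) × (Fin u → unitInterval)) × (Sketch u n × Sketch u n))
    (i : Fin (levels u)) :
    levelBits (mergedSketch w A B ω) i = levelBits (ω.2.1 + ω.2.2) i +
      ∑ j, contribution (sampleSet w (A ∆ B) i j) (ω.1.1 j, ω.1.2 j) := by
  rw [mergedSketch, noisySketch_add, levelBits_noisySketch]

lemma measurable_exp_signSum {u n : ℕ} (w : Fin u → ℝ) (A B : Finset (Fin u))
    (i : Fin (levels u)) (l : ℝ) : Measurable
      fun ω : ((Fin u → Fin n) × (Fin u → unitInterval)) × (Sketch u n × Sketch u n) =>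
        ENNReal.ofReal (Real.exp (l * signSum (levelBits (mergedSketch w A B ω) i))) := by
  have hG : Measurable fun y : Fin n → ZMod 2 => ENNReal.ofReal (Real.exp (l * signSum y)) :=
    measurable_of_finite _
  refine hG.comp ?_
  simp only [levelBits_mergedSketch]
  apply Measurable.fun_add
  · exact (measurable_of_finite fun p : Sketch u n × Sketch u n => levelBits (p.1 + p.2) i).comp
      measurable_snd
  · refine Finset.measurable_sum _ fun j _ => ?_
    exact (measurable_contribution (measurableSet_sampleSet w (A ∆ B) i j)).comp (by fun_prop)

/-- The mean sign of a bit on level `i` of the noiseless sketch of a set with weight vector `v`. -/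
def meanSign {u : ℕ} (n : ℕ) (v : Fin u → ℝ) (i : ℕ) : ℝ := ∏ j, (1 - v j / (2 ^ i * n))

lemma weightVec_mem {u : ℕ} {w : Fin u → ℝ} (hw : ∀ j, 0 < w j ∧ w j ≤ 1) (D : Finset (Fin u))
    (j : Fin u) : 0 ≤ weightVec w D j ∧ weightVec w D j ≤ 1 := by
  unfold weightVec
  split_ifs
  · exact ⟨(hw j).1.le, (hw j).2⟩
  · norm_num

lemma mergedSketch_moment {u n : ℕ} (hn : 2 ≤ n) {ε l : ℝ} (hε : 0 < ε) (hl : |l| ≤ 1 / 2)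
    {w : Fin u → ℝ} (hw : ∀ j, 0 < w j ∧ w j ≤ 1) (A B : Finset (Fin u)) (i : Fin (levels u)) :
    ∫⁻ ω, ENNReal.ofReal (Real.exp (l * signSum (levelBits (mergedSketch w A B ω) i)))
      ∂(jointLaw u n ε) ≤
    ENNReal.ofReal (Real.exp (n * (l * (meanSign n (weightVec w (A ∆ B)) i *
      (1 / (2 / mergedParam ε + 1)))) + 2 * n * l ^ 2)) := by
  have hn0 : 0 < n := by omega
  have := isProbabilityMeasure_hashLaw u n hn0
  have := isProbabilityMeasure_noiseLaw u n hε
  set v := weightVec w (A ∆ B) with hv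
  set m := meanSign n v i with hm
  have hv01 := weightVec_mem hw (A ∆ B)
  have hq1 : ∀ j, v j / 2 ^ ((i : ℕ) + 1) ≤ 1 := fun j =>
    (div_le_one (by positivity)).2 ((hv01 j).2.trans (one_le_pow₀ (by norm_num)))
  have hm' : ∏ j, (1 - 2 * (v j / 2 ^ ((i : ℕ) + 1)) / n) = m := by
    refine Finset.prod_congr rfl fun j _ => ?_
    rw [pow_succ]
    congr 1
    field_simp
  have hn' : (2 : ℝ) ≤ n := by exact_mod_cast hn
  have hfac : ∀ j, 0 ≤ 1 - v j / (2 ^ (i : ℕ) * n) ∧ 1 - v j / (2 ^ (i : ℕ) * n) ≤ 1 := by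
    intro j
    have h1 : (1 : ℝ) ≤ 2 ^ (i : ℕ) * n := by
      have : (1 : ℝ) ≤ 2 ^ (i : ℕ) := one_le_pow₀ (by norm_num)
      nlinarith
    have h2 : v j / (2 ^ (i : ℕ) * n) ≤ 1 := (div_le_one (by linarith)).2 (by linarith [(hv01 j).2])
    have h3 : 0 ≤ v j / (2 ^ (i : ℕ) * n) := div_nonneg (hv01 j).1 (by linarith)
    constructor <;> linarith
  have hm0 : 0 ≤ m := Finset.prod_nonneg fun j _ => (hfac j).1
  have hm1 : m ≤ 1 := Finset.prod_le_one (fun j _ => (hfac j).1) fun j _ => (hfac j).2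
  -- The hash functions are integrated first, for fixed noise. The outcome depends on the noise only
  -- through an exponential of the same form with `l` contracted to `l * m`.
  rw [lintegral_prod_symm' _ (measurable_exp_signSum w A B i l)]
  have hin : ∀ p : Sketch u n × Sketch u n, ∫⁻ x, ENNReal.ofReal (Real.exp (l * signSum
      (levelBits (mergedSketch w A B (x, p)) i))) ∂(hashLaw u n) ≤
      ENNReal.ofReal (Real.exp (2 * n * l ^ 2 * (1 - m))) *
      ENNReal.ofReal (Real.exp (l * m * signSum (levelBits (p.1 + p.2) i))) := by
    intro p
    rw [lintegral_hashLaw u n hn0]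
    simp only [levelBits_mergedSketch]
    refine (flips_moment hn (levelBits (p.1 + p.2) i) (measurableSet_sampleSet w (A ∆ B) i)
      (fun j => div_nonneg (hv01 j).1 (by positivity)) hq1 (volume_sampleSet hw (A ∆ B) i)
      hl).trans (le_of_eq ?_)
    rw [← ENNReal.ofReal_mul (Real.exp_pos _).le, ← Real.exp_add, hm', add_comm]
  refine (lintegral_mono hin).trans ?_
  rw [lintegral_const_mul' _ _ ENNReal.ofReal_ne_top]
  have hmap : ∫⁻ p, ENNReal.ofReal (Real.exp (l * m * signSum (levelBits (p.1 + p.2) i)))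
      ∂((noiseLaw u n ε).prod (noiseLaw u n ε)) =
      ∫⁻ ζ, ENNReal.ofReal (Real.exp (l * m * signSum (levelBits ζ i)))
        ∂(noiseLaw u n (mergedParam ε)) := by
    rw [← map_add_noiseLaw u n hε, lintegral_map (measurable_of_finite _) (measurable_of_finite _)]
  rw [hmap]
  have hlm : |l * m| ≤ 1 := by
    rw [abs_mul, abs_of_nonneg hm0]
    nlinarith [abs_nonneg l]
  refine (mul_le_mul_right (noise_moment u n (mergedParam_pos hε) hlm i) _).trans ?_
  rw [← ENNReal.ofReal_mul (Real.exp_pos _).le, ← Real.exp_add]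
  apply ENNReal.ofReal_le_ofReal
  apply Real.exp_le_exp.2
  -- The two variance terms add up to `n * l ^ 2 * (2 * (1 - m) + m ^ 2)`, which falls short of `2 *
  -- n * l ^ 2` by exactly this quantity.
  have : 0 ≤ n * l ^ 2 * (m * (2 - m)) := by
    have : 0 ≤ m * (2 - m) := mul_nonneg hm0 (by linarith)
    positivity
  nlinarith

/-- The Chernoff bound, in terms of a bound for the exponential moment. -/
lemma chernoff {Ω : Type*} [MeasurableSpace Ω] (μ : Measure Ω) {X : Ω → ℝ} {l a K : ℝ}
    (hm : Measurable fun ω => ENNReal.ofReal (Real.exp (l * X ω)))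
    (hX : ∫⁻ ω, ENNReal.ofReal (Real.exp (l * X ω)) ∂μ ≤ ENNReal.ofReal (Real.exp K)) :
    μ {ω | a ≤ l * X ω} ≤ ENNReal.ofReal (Real.exp (K - a)) := by
  have h := mul_meas_ge_le_lintegral (μ := μ) hm (ENNReal.ofReal (Real.exp a))
  have hsub : {ω | a ≤ l * X ω} ⊆
      {ω | ENNReal.ofReal (Real.exp a) ≤ ENNReal.ofReal (Real.exp (l * X ω))} := fun ω hω =>
    ENNReal.ofReal_le_ofReal (Real.exp_le_exp.2 hω)
  have hpos : ENNReal.ofReal (Real.exp a) ≠ 0 := by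
    simpa using Real.exp_pos a
  rw [Real.exp_sub, ENNReal.ofReal_div_of_pos (Real.exp_pos a)]
  rw [ENNReal.le_div_iff_mul_le (Or.inl hpos) (Or.inl ENNReal.ofReal_ne_top), mul_comm]
  exact (mul_le_mul_right (measure_mono hsub) _).trans (h.trans hX)

/-- Chernoff's bound on both sides with `l = ± t / 4`, the minimiser of `2 * n * l ^ 2 - n * t *
|l|`; `t ≤ 2` makes this `l` admissible. -/
lemma level_tail {u n : ℕ} (hn : 2 ≤ n) {ε t : ℝ} (hε : 0 < ε) (ht0 : 0 ≤ t) (ht2 : t ≤ 2)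
    {w : Fin u → ℝ} (hw : ∀ j, 0 < w j ∧ w j ≤ 1) (A B : Finset (Fin u)) (i : Fin (levels u)) :
    jointLaw u n ε {ω | n * t ≤ |signSum (levelBits (mergedSketch w A B ω) i) -
      n * (meanSign n (weightVec w (A ∆ B)) i * (1 / (2 / mergedParam ε + 1)))|} ≤
    ENNReal.ofReal (2 * Real.exp (-(t ^ 2 * n / 8))) := by
  set m := meanSign n (weightVec w (A ∆ B)) i * (1 / (2 / mergedParam ε + 1)) with hmdef
  have hl1 : |t / 4| ≤ 1 / 2 := by rw [abs_of_nonneg (by linarith)]; linarith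
  have hl2 : |-(t / 4)| ≤ 1 / 2 := by rw [abs_neg]; exact hl1
  have c1 := chernoff (jointLaw u n ε) (a := t / 4 * (n * m + n * t))
    (measurable_exp_signSum w A B i _) (mergedSketch_moment hn hε hl1 hw A B i)
  have c2 := chernoff (jointLaw u n ε) (a := -(t / 4) * (n * m - n * t))
    (measurable_exp_signSum w A B i _) (mergedSketch_moment hn hε hl2 hw A B i)
  rw [← hmdef] at c1 c2
  have e1 : n * (t / 4 * m) + 2 * n * (t / 4) ^ 2 - t / 4 * (n * m + n * t) =
      -(t ^ 2 * n / 8) := by ring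
  have e2 : n * (-(t / 4) * m) + 2 * n * (-(t / 4)) ^ 2 - -(t / 4) * (n * m - n * t) =
      -(t ^ 2 * n / 8) := by ring
  rw [e1] at c1
  rw [e2] at c2
  rw [two_mul, ENNReal.ofReal_add (Real.exp_pos _).le (Real.exp_pos _).le]
  refine le_trans (le_trans (measure_mono ?_) (measure_union_le _ _)) (add_le_add c1 c2)
  intro ω hω
  rcases le_abs.1 (Set.mem_ofPred_eq ▸ hω) with h | h
  · left
    simp only [Set.mem_ofPred_eq]
    exact mul_le_mul_of_nonneg_left (by linarith) (by linarith)
  · right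
    simp only [Set.mem_ofPred_eq]
    rw [neg_mul, neg_mul]
    exact neg_le_neg (mul_le_mul_of_nonneg_left (by linarith) (by linarith))

lemma levels_le (u : ℕ) : levels u ≤ u := by
  exact Nat.clog_le_of_le_pow u.lt_two_pow_self.le

/-- With high probability, all levels are close to their means. -/
lemma all_levels_close {u n : ℕ} (hu : 1 ≤ u) (hn : 2 ≤ n) {ε t : ℝ} (hε : 0 < ε) (ht0 : 0 < t)
    (ht2 : t ≤ 2) (hnt : 8 * (1 / t) ^ 2 * (2 * Real.log u + 1) ≤ n)
    {w : Fin u → ℝ} (hw : ∀ j, 0 < w j ∧ w j ≤ 1) (A B : Finset (Fin u)) :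
    1 - 1 / (u : ℝ) ≤ (jointLaw u n ε).real {ω | ∀ i : Fin (levels u),
      |signSum (levelBits (mergedSketch w A B ω) i) -
      n * (meanSign n (weightVec w (A ∆ B)) i * (1 / (2 / mergedParam ε + 1)))| < n * t} := by
  have hn0 : 0 < n := by omega
  have := isProbabilityMeasure_hashLaw u n hn0
  have := isProbabilityMeasure_noiseLaw u n hε
  have hu' : (1 : ℝ) ≤ u := by exact_mod_cast hu
  set S := {ω | ∀ i : Fin (levels u),
      |signSum (levelBits (mergedSketch w A B ω) i) -
      n * (meanSign n (weightVec w (A ∆ B)) i * (1 / (2 / mergedParam ε + 1)))| < n * t} with hS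
  -- A failure probability of `1 / u ^ 2` per level suffices for the union bound, since there are at
  -- most `u` levels.
  have hexp : 2 * Real.exp (-(t ^ 2 * n / 8)) ≤ 1 / (u : ℝ) ^ 2 := by
    have h1 : 2 * Real.log u + 1 ≤ t ^ 2 * n / 8 := by
      have := mul_le_mul_of_nonneg_left hnt (by positivity : 0 ≤ t ^ 2 / 8)
      have e : t ^ 2 / 8 * (8 * (1 / t) ^ 2 * (2 * Real.log u + 1)) = 2 * Real.log u + 1 := by
        field_simp
      linarith
    have h2 : Real.exp (-(t ^ 2 * n / 8)) ≤ Real.exp (-(2 * Real.log u + 1)) :=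
      Real.exp_le_exp.2 (by linarith)
    have h3 : Real.exp (-(2 * Real.log u + 1)) = 1 / (u : ℝ) ^ 2 * (1 / Real.exp 1) := by
      rw [Real.exp_neg, Real.exp_add, two_mul, Real.exp_add, Real.exp_log (by linarith)]
      field_simp
    have h4 : 1 / Real.exp 1 ≤ 1 / 2 :=
      one_div_le_one_div_of_le (by norm_num) (by linarith [Real.add_one_le_exp 1])
    have h5 : 0 ≤ 1 / (u : ℝ) ^ 2 := by positivity
    nlinarith
  have hc : jointLaw u n ε Sᶜ ≤ ENNReal.ofReal (1 / u) := by
    have e : Sᶜ = ⋃ i : Fin (levels u), {ω | n * t ≤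
        |signSum (levelBits (mergedSketch w A B ω) i) -
          n * (meanSign n (weightVec w (A ∆ B)) i * (1 / (2 / mergedParam ε + 1)))|} := by
      ext ω
      simp [hS]
    rw [e]
    refine (measure_iUnion_fintype_le _ _).trans ?_
    refine (Finset.sum_le_sum fun i _ => (level_tail hn hε ht0.le ht2 hw A B i).trans
      (ENNReal.ofReal_le_ofReal hexp)).trans ?_
    rw [Finset.sum_const, Finset.card_univ, Fintype.card_fin, nsmul_eq_mul,
      ← ENNReal.ofReal_natCast, ← ENNReal.ofReal_mul (by positivity)]
    apply ENNReal.ofReal_le_ofReal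
    calc (levels u : ℝ) * (1 / (u : ℝ) ^ 2) ≤ (u : ℝ) * (1 / (u : ℝ) ^ 2) := by
          gcongr
          exact_mod_cast levels_le u
      _ = 1 / (u : ℝ) := by field_simp
  -- Subadditivity suffices here, so measurability of `S` is not needed.
  have hone : 1 ≤ (jointLaw u n ε).real S + (jointLaw u n ε).real Sᶜ := by
    have h := measureReal_union_le (μ := jointLaw u n ε) S Sᶜ
    rwa [Set.union_compl_self, probReal_univ] at h
  have hc' : (jointLaw u n ε).real Sᶜ ≤ 1 / u := by
    rw [measureReal_def]
    exact ENNReal.toReal_le_of_le_ofReal (by positivity) hc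
  linarith

/-! ### Accuracy of the estimate on good sketches -/

/-- The relative frequency of ones on each level is within a factor `1 ± γ` of its mean for
weight `W`. -/
def IsClose {u n : ℕ} (ε γ W : ℝ) (z : Sketch u n) : Prop :=
  ∀ i : Fin (levels u),
    (1 - γ) * (1 - Real.exp (-(W / (2 ^ (i : ℕ) * n))) / (2 / ε + 1)) ≤ 2 * onesCount z i / n ∧
    2 * onesCount z i / n ≤ (1 + γ) * (1 - Real.exp (-(W / (2 ^ (i : ℕ) * n))) / (2 / ε + 1))

lemma log_ratio_le {T a x : ℝ} (hT : 0 < T) (ha : 0 < a) (h : Real.exp (-x) / T ≤ a) :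
    Real.log (1 / T / a) ≤ x := by
  rw [Real.log_le_iff_le_exp (by positivity), div_le_iff₀ ha]
  have := mul_le_mul_of_nonneg_left h (Real.exp_pos x).le
  rwa [← mul_div_assoc, ← Real.exp_add, add_neg_cancel, Real.exp_zero] at this

lemma le_log_ratio {T a x : ℝ} (hT : 0 < T) (ha : 0 < a) (h : a ≤ Real.exp (-x) / T) :
    x ≤ Real.log (1 / T / a) := by
  rw [Real.le_log_iff_exp_le (by positivity), le_div_iff₀ ha]
  have := mul_le_mul_of_nonneg_left h (Real.exp_pos x).le
  rwa [← mul_div_assoc, ← Real.exp_add, add_neg_cancel, Real.exp_zero] at this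

lemma one_sub_div_bounds {γ y r : ℝ} (h0 : 0 < γ) (h1 : γ < 1) (hl : (1 - γ) * (1 - r) ≤ y)
    (hr : y ≤ (1 + γ) * (1 - r)) : 1 - y / (1 - γ) ≤ r ∧ r ≤ 1 - y / (1 + γ) := by
  have h2 : 1 - r ≤ y / (1 - γ) := by rw [le_div_iff₀ (by linarith)]; linarith
  have h3 : y / (1 + γ) ≤ 1 - r := by rw [div_le_iff₀ (by linarith)]; linarith
  constructor <;> linarith

/-- Closeness traps `exp (-x) / T` between `1 - y / (1 - γ)` and `1 - y / (1 + γ)`, where `y` is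
twice the frequency of ones, `T = 2 / ε + 1` and `x` is the scaled weight; taking logarithms solves
for `x`. Outside the trivial case `y < 1 - γ`, so both logarithms have positive arguments. -/
lemma mem_levelInterval {u n : ℕ} (hn : 0 < n) {ε γ W : ℝ} (hε : 0 < ε) (hγ0 : 0 < γ)
    (hγ1 : γ < 1) (hW0 : 0 ≤ W) (hWu : W ≤ u) {z : Sketch u n} (hz : IsClose ε γ W z)
    (i : Fin (levels u)) : W ∈ levelInterval ε γ z i := by
  have hn' : (0 : ℝ) < n := by exact_mod_cast hn
  have hT : 0 < 2 / ε + 1 := by positivity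
  obtain ⟨hl, hr⟩ := hz i
  unfold levelInterval
  split_ifs with hb
  · exact ⟨hW0, hWu⟩
  · have hscale : (0 : ℝ) < 2 ^ (i : ℕ) * n := by positivity
    set x := W / (2 ^ (i : ℕ) * n) with hx
    have hWx : W = 2 ^ (i : ℕ) * n * x := by rw [hx]; field_simp
    set y := 2 * (onesCount z i : ℝ) / n with hy
    have hy1 : y < 1 - γ := by
      rw [hy, div_lt_iff₀ hn']
      linarith
    have e1 : 2 * (onesCount z i : ℝ) / ((1 + γ) * n) = y / (1 + γ) := by
      rw [hy, div_div, mul_comm (n : ℝ)]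
    have e2 : 2 * (onesCount z i : ℝ) / ((1 - γ) * n) = y / (1 - γ) := by
      rw [hy, div_div, mul_comm (n : ℝ)]
    rw [e1, e2]
    obtain ⟨b1, b2⟩ := one_sub_div_bounds hγ0 hγ1 hl hr
    have a2 : 0 < 1 - y / (1 - γ) := by
      rw [sub_pos, div_lt_one (by linarith)]; exact hy1
    have a1 : 0 < 1 - y / (1 + γ) := by
      rw [sub_pos, div_lt_one (by linarith)]; linarith
    refine ⟨?_, ?_⟩
    · rw [hWx]
      exact mul_le_mul_of_nonneg_left (log_ratio_le hT a1 b2) hscale.le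
    · conv_lhs => rw [hWx]
      exact mul_le_mul_of_nonneg_left (le_log_ratio hT a2 b1) hscale.le

/-- The endpoints of the interval of a level whose scale matches the weight are close. -/
lemma levelInterval_ratio {u n : ℕ} (hn : 0 < n) {ε γ W : ℝ} (hε : 0 < ε) (hγ0 : 0 < γ)
    (hγ : 16 * (γ * (Real.exp 3 * (2 / ε + 1))) ≤ 1) {z : Sketch u n}
    (hz : IsClose ε γ W z) (i : Fin (levels u)) (h1 : 1 ≤ W / (2 ^ (i : ℕ) * n))
    (h3 : W / (2 ^ (i : ℕ) * n) ≤ 3) :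
    ∃ a b : ℝ, levelInterval ε γ z i = Set.Icc a b ∧ b ≤ (1 + ratioTolerance ε γ) * a := by
  have hn' : (0 : ℝ) < n := by exact_mod_cast hn
  have hT : 1 < 2 / ε + 1 := by linarith [show 0 < 2 / ε by positivity]
  obtain ⟨hl, hr⟩ := hz i
  unfold ratioTolerance
  set T := 2 / ε + 1 with hTdef
  set K := Real.exp 3 * T with hK
  have hexp3 : 1 ≤ Real.exp 3 := Real.one_le_exp (by norm_num)
  have hK1 : 1 < K := by rw [hK]; nlinarith
  have hγ1 : γ < 1 := by nlinarith
  set x := W / (2 ^ (i : ℕ) * n) with hx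
  set y := 2 * (onesCount z i : ℝ) / n with hy
  -- The upper bound `x ≤ 3` enters here: the signal `exp (-x) / T` is at least `1 / K`, which keeps
  -- `y` away from `1 - γ`.
  have hr1 : 1 / K ≤ Real.exp (-x) / T := by
    rw [hK, ← div_div, one_div, ← Real.exp_neg]
    gcongr
  have hyK : y ≤ (1 + γ) * (1 - 1 / K) := hr.trans (by gcongr)
  have hden : 0 < 1 + γ - 2 * γ * K := by nlinarith
  have hKi : K * (1 / K) = 1 := by field_simp
  have hy1 : y < 1 - γ := by
    have : (1 + γ) * (1 - 1 / K) < 1 - γ := by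
      have h5 : 2 * γ < (1 + γ) / K := by
        rw [lt_div_iff₀ (by linarith)]; linarith
      have h6 : (1 + γ) * (1 - 1 / K) = 1 + γ - (1 + γ) / K := by ring
      linarith
    linarith
  have hscale : (0 : ℝ) < 2 ^ (i : ℕ) * n := by positivity
  have e1 : 2 * (onesCount z i : ℝ) / ((1 + γ) * n) = y / (1 + γ) := by
    rw [hy, div_div, mul_comm (n : ℝ)]
  have e2 : 2 * (onesCount z i : ℝ) / ((1 - γ) * n) = y / (1 - γ) := by
    rw [hy, div_div, mul_comm (n : ℝ)]
  have hb : ¬ (1 - γ) * n / 2 ≤ (onesCount z i : ℝ) := by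
    rw [hy, div_lt_iff₀ hn'] at hy1
    linarith
  obtain ⟨b1, b2⟩ := one_sub_div_bounds hγ0 hγ1 hl hr
  set A := 1 - y / (1 + γ) with hA
  set B := 1 - y / (1 - γ) with hB
  have a2 : 0 < B := by rw [hB, sub_pos, div_lt_one (by linarith)]; exact hy1
  have a1 : 0 < A := by rw [hA, sub_pos, div_lt_one (by linarith)]; linarith
  refine ⟨2 ^ (i : ℕ) * n * Real.log (1 / T / A), 2 ^ (i : ℕ) * n * Real.log (1 / T / B), ?_, ?_⟩
  · unfold levelInterval
    rw [if_neg hb, e1, e2]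
  · set η := 6 * γ * (K - 1) / (1 + γ - 2 * γ * K) with hη
    have hη0 : 0 ≤ η := by
      apply div_nonneg _ hden.le
      have : 0 ≤ K - 1 := by linarith
      positivity
    have hη2 : η ≤ 2 := by
      rw [hη, div_le_iff₀ hden]
      nlinarith
    have hup : x ≤ Real.log (1 / T / B) := le_log_ratio (by linarith) a2 b1
    have hBlow : (1 + γ - 2 * γ * K) / (K * (1 - γ)) ≤ B := by
      have h5 : y / (1 - γ) ≤ (1 + γ) * (1 - 1 / K) / (1 - γ) :=
        div_le_div_of_nonneg_right hyK (by linarith)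
      have h6 : 1 - (1 + γ) * (1 - 1 / K) / (1 - γ) = (1 + γ - 2 * γ * K) / (K * (1 - γ)) := by
        have : 1 - γ ≠ 0 := by linarith
        field_simp
        ring
      rw [hB, ← h6]
      linarith
    have hAB : A - B ≤ 2 * γ * (K - 1) / (K * (1 - γ)) := by
      have h5 : A - B = y * (2 * γ / ((1 + γ) * (1 - γ))) := by
        rw [hA, hB]
        have : 1 - γ ≠ 0 := by linarith
        field_simp
        ring
      have h6 : (1 + γ) * (1 - 1 / K) * (2 * γ / ((1 + γ) * (1 - γ))) =
          2 * γ * (K - 1) / (K * (1 - γ)) := by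
        have : 1 - γ ≠ 0 := by linarith
        field_simp
      rw [h5, ← h6]
      apply mul_le_mul_of_nonneg_right hyK
      have : 0 ≤ 1 - γ := by linarith
      positivity
    -- By `log (A / B) ≤ (A - B) / B`, the bounds on `A - B` and `B` combine to `2 * γ * (K - 1) /
    -- (1 + γ - 2 * γ * K)`, a third of the tolerance.
    have hlog : Real.log (1 / T / B) - Real.log (1 / T / A) ≤ η / 3 := by
      have hpos : 0 < 1 / T := by positivity
      rw [Real.log_div hpos.ne' a2.ne', Real.log_div hpos.ne' a1.ne']
      have h5 : Real.log (A / B) ≤ A / B - 1 := Real.log_le_sub_one_of_pos (by positivity)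
      rw [Real.log_div a1.ne' a2.ne'] at h5
      have h6 : A / B - 1 ≤ η / 3 := by
        rw [div_sub_one a2.ne', div_le_iff₀ a2]
        have h7 : η / 3 * ((1 + γ - 2 * γ * K) / (K * (1 - γ))) =
            2 * γ * (K - 1) / (K * (1 - γ)) := by
          rw [hη]
          have h9 : 1 - γ ≠ 0 := by linarith
          generalize 1 + γ - 2 * γ * K = d at hden ⊢
          generalize 1 - γ = e at h9 ⊢
          field_simp
          ring
        have h8 := mul_le_mul_of_nonneg_left hBlow (by linarith : 0 ≤ η / 3)
        linarith
      linarith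
    -- The upper logarithm is at least `x ≥ 1`, so the lower one is at least `1 - η / 3 ≥ 1 / 3`.
    -- The difference `η / 3` is thus at most `η` times the lower logarithm; this explains the
    -- factor `6` in the tolerance.
    rw [mul_left_comm]
    apply mul_le_mul_of_nonneg_left _ hscale.le
    nlinarith

/-- The scales double from level to level, so one of them is within a factor of two below `W`. As `2
^ i * n ≤ W ≤ u` and `n ≥ 2`, its index satisfies `2 ^ i < u` and is a level of the sketch. -/
lemma exists_matching_level {u n : ℕ} (hn : 2 ≤ n) {W : ℝ} (hnW : n ≤ W) (hWu : W ≤ u) :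
    ∃ i : Fin (levels u), 1 ≤ W / (2 ^ (i : ℕ) * n) ∧ W / (2 ^ (i : ℕ) * n) ≤ 3 := by
  have hn' : (2 : ℝ) ≤ n := by exact_mod_cast hn
  obtain ⟨i, hi1, hi2⟩ := exists_nat_pow_near (x := W / n) (y := (2 : ℝ))
    ((one_le_div (by linarith)).2 hnW) (by norm_num)
  have hp : (0 : ℝ) < 2 ^ i := by positivity
  have h1 : 2 ^ i * n ≤ W := (le_div_iff₀ (by linarith)).1 hi1
  have h2 : W < 2 ^ (i + 1) * n := (div_lt_iff₀ (by linarith)).1 hi2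
  have hiu : 2 ^ i < u := by
    have : (2 : ℝ) ^ i < u := by nlinarith
    exact_mod_cast this
  refine ⟨⟨i, (Nat.lt_clog_iff_pow_lt (by norm_num)).2 hiu⟩, ?_, ?_⟩
  · rw [one_le_div (by positivity)]
    exact h1
  · rw [div_le_iff₀ (by positivity)]
    rw [pow_succ] at h2
    nlinarith

lemma estimateInterval_subset {u n : ℕ} (ε γ : ℝ) (z : Sketch u n) (i : Fin (levels u)) :
    estimateInterval ε γ z ⊆ levelInterval ε γ z i := Set.iInter_subset _ i

lemma levelInterval_eq_Icc {u n : ℕ} (ε γ : ℝ) (z : Sketch u n) (i : Fin (levels u)) :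
    ∃ a b : ℝ, levelInterval ε γ z i = Set.Icc a b := by
  unfold levelInterval
  split_ifs
  · exact ⟨_, _, rfl⟩
  · exact ⟨_, _, rfl⟩

/-- The true weight always lies in the intersection. If the ratio test passes, so do the minimum and
maximum enclose it within the tolerance; if it fails, the matching level rules out `W ≥ n`. -/
lemma estimate_error {u n : ℕ} (hu : 2 ≤ u) (hn : 2 ≤ n) {ε γ W : ℝ} (hε : 0 < ε) (hγ0 : 0 < γ)
    (hγ : 16 * (γ * (Real.exp 3 * (2 / ε + 1))) ≤ 1) (hW0 : 0 ≤ W) (hWu : W ≤ u)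
    {z : Sketch u n} (hz : IsClose ε γ W z) :
    |W - estimate ε γ z| ≤ ratioTolerance ε γ * W ∨ |W - estimate ε γ z| < n := by
  have hn0 : 0 < n := by omega
  have hT : 1 < 2 / ε + 1 := by linarith [show 0 < 2 / ε by positivity]
  have hexp3 : 1 ≤ Real.exp 3 := Real.one_le_exp (by norm_num)
  have hK1 : 1 < Real.exp 3 * (2 / ε + 1) := by nlinarith
  have hγ1 : γ < 1 := by nlinarith
  have hη0 : 0 ≤ ratioTolerance ε γ := by
    unfold ratioTolerance
    apply div_nonneg
    · have : 0 ≤ Real.exp 3 * (2 / ε + 1) - 1 := by linarith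
      positivity
    · nlinarith
  have hmem : W ∈ estimateInterval ε γ z :=
    Set.mem_iInter.2 fun i => mem_levelInterval hn0 hε hγ0 hγ1 hW0 hWu hz i
  -- At least one level is needed: an empty intersection of intervals would be all of `ℝ`, without
  -- meaningful infimum and supremum.
  have hlev : 0 < levels u := Nat.clog_pos (by norm_num) hu
  obtain ⟨a, b, hab⟩ := levelInterval_eq_Icc ε γ z ⟨0, hlev⟩
  have hsub := hab ▸ estimateInterval_subset ε γ z ⟨0, hlev⟩
  have hinf : sInf (estimateInterval ε γ z) ≤ W := csInf_le (bddBelow_Icc.mono hsub) hmem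
  have hsup : W ≤ sSup (estimateInterval ε γ z) := le_csSup (bddAbove_Icc.mono hsub) hmem
  by_cases hc : (estimateInterval ε γ z).Nonempty ∧ sSup (estimateInterval ε γ z) ≤
      (1 + ratioTolerance ε γ) * sInf (estimateInterval ε γ z)
  · left
    rw [estimate, if_pos hc, abs_of_nonneg (by linarith)]
    have := mul_le_mul_of_nonneg_left hinf hη0
    linarith [hc.2]
  · right
    rw [estimate, if_neg hc, sub_zero, abs_of_nonneg hW0]
    by_contra hlt
    apply hc
    obtain ⟨i, h1, h3⟩ := exists_matching_level hn (not_lt.1 hlt) hWu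
    obtain ⟨a, b, hab, hr⟩ := levelInterval_ratio hn0 hε hγ0 hγ hz i h1 h3
    have hsub := hab ▸ estimateInterval_subset ε γ z i
    have hne : (estimateInterval ε γ z).Nonempty := ⟨W, hmem⟩
    refine ⟨hne, (csSup_le hne fun x hx => (hsub hx).2).trans (hr.trans ?_)⟩
    exact mul_le_mul_of_nonneg_left (le_csInf hne fun x hx => (hsub hx).1) (by linarith)

/-! ### Concentration implies good sketches -/

/-- Above, `1 - c ≤ exp (-c)`. Below, `1 - c ≥ exp (-c * (1 + 2 / n))` for `0 ≤ c ≤ 1 / n ≤ 1 / 2`;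
the extra factor costs at most `2 * x * exp (-x) / n ≤ 2 / n`, uniformly in the total `x`. -/
lemma meanSign_bounds {u n : ℕ} (hn : 2 ≤ n) {v : Fin u → ℝ} (hv : ∀ j, 0 ≤ v j ∧ v j ≤ 1)
    (i : ℕ) : meanSign n v i ≤ Real.exp (-((∑ j, v j) / (2 ^ i * n))) ∧
      Real.exp (-((∑ j, v j) / (2 ^ i * n))) - 2 / n ≤ meanSign n v i := by
  have hn' : (2 : ℝ) ≤ n := by exact_mod_cast hn
  have hp : (1 : ℝ) ≤ 2 ^ i := one_le_pow₀ (by norm_num)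
  have hc : ∀ j, 0 ≤ v j / (2 ^ i * n) ∧ v j / (2 ^ i * n) ≤ 1 / n := by
    intro j
    refine ⟨div_nonneg (hv j).1 (by positivity), ?_⟩
    rw [div_le_div_iff₀ (by positivity) (by linarith)]
    nlinarith [(hv j).2, mul_le_mul_of_nonneg_right hp (by linarith : (0 : ℝ) ≤ n)]
  have hni : 1 / (n : ℝ) ≤ 1 / 2 := one_div_le_one_div_of_le (by norm_num) hn'
  rw [Finset.sum_div]
  unfold meanSign
  set c : Fin u → ℝ := fun j => v j / (2 ^ i * n) with hcdef
  change ∏ j, (1 - c j) ≤ Real.exp (-∑ j, c j) ∧ Real.exp (-∑ j, c j) - 2 / n ≤ ∏ j, (1 - c j)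
  set x := ∑ j, c j with hx
  have hx0 : 0 ≤ x := Finset.sum_nonneg fun j _ => (hc j).1
  constructor
  · rw [hx, ← Finset.sum_neg_distrib, Real.exp_sum]
    refine Finset.prod_le_prod (fun j _ => by linarith [(hc j).2]) fun j _ => ?_
    linarith [Real.add_one_le_exp (-c j)]
  · have h1 : Real.exp (-(x * (1 + 2 / n))) ≤ ∏ j, (1 - c j) := by
      rw [hx, Finset.sum_mul, ← Finset.sum_neg_distrib, Real.exp_sum]
      refine Finset.prod_le_prod (fun j _ => (Real.exp_pos _).le) fun j _ => ?_
      obtain ⟨c0, c1⟩ := hc j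
      have c0' : 0 ≤ c j := c0
      have c1' : c j ≤ 1 / n := c1
      have hpos : 0 < 1 - c j := by linarith
      have h2 : 1 / (1 - c j) ≤ Real.exp (c j * (1 + 2 / n)) := by
        have h3 : 1 / (1 - c j) ≤ 1 + c j * (1 + 2 / n) := by
          rw [div_le_iff₀ hpos]
          have h4 : 2 / (n : ℝ) = 2 * (1 / n) := by ring
          rw [h4]
          nlinarith [mul_nonneg c0' (sub_nonneg.2 c1'), mul_nonneg (mul_nonneg c0' c0')
            (sub_nonneg.2 hni), mul_nonneg c0' (sub_nonneg.2 (c1'.trans hni)),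
            mul_nonneg (mul_nonneg c0' (by positivity : 0 ≤ 1 / (n : ℝ)))
              (sub_nonneg.2 (c1'.trans hni))]
        linarith [Real.add_one_le_exp (c j * (1 + 2 / n))]
      rw [Real.exp_neg, inv_le_comm₀ (Real.exp_pos _) hpos]
      simpa using h2
    refine le_trans ?_ h1
    have h2 : -(x * (1 + 2 / n)) = -x + -(x * (2 / n)) := by ring
    rw [h2, Real.exp_add]
    have h3 : x * Real.exp (-x) ≤ 1 := by
      have h4 := Real.add_one_le_exp x
      have h5 : Real.exp x * Real.exp (-x) = 1 := by rw [← Real.exp_add]; simp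
      have h6 := Real.exp_pos (-x)
      nlinarith
    have h4 := mul_le_mul_of_nonneg_left (Real.add_one_le_exp (-(x * (2 / n))))
      (Real.exp_pos (-x)).le
    have h5 := mul_le_mul_of_nonneg_right h3 (by positivity : (0 : ℝ) ≤ 2 / n)
    nlinarith

/-- The random deviation and the error of replacing the product by an exponential each take half of
the budget `γ * (1 - τ)`, where `τ = 1 / (2 / ε + 1)`. Since the exponential `X` is at most `1`,
this is at most `γ * (1 - X * τ)`, so the absolute error is a relative one. -/
lemma isClose_of_concentrated {u n : ℕ} (hn : 2 ≤ n) {ε γ : ℝ} (hε : 0 < ε) (hγ0 : 0 < γ)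
    {v : Fin u → ℝ} (hv : ∀ j, 0 ≤ v j ∧ v j ≤ 1) {z : Sketch u n}
    (hnt : 2 / n ≤ γ * (1 - 1 / (2 / ε + 1)) / 2)
    (hz : ∀ i : Fin (levels u), |signSum (levelBits z i) -
      n * (meanSign n v i * (1 / (2 / ε + 1)))| < n * (γ * (1 - 1 / (2 / ε + 1)) / 2)) :
    IsClose ε γ (∑ j, v j) z := by
  intro i
  have hn' : (2 : ℝ) ≤ n := by exact_mod_cast hn
  have hT : 1 < 2 / ε + 1 := by linarith [show 0 < 2 / ε by positivity]
  have h := hz i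
  rw [signSum_levelBits] at h
  obtain ⟨m1, m2⟩ := meanSign_bounds hn hv i
  have hs0 : 0 ≤ ∑ j, v j := Finset.sum_nonneg fun j _ => (hv j).1
  have hE1 : Real.exp (-((∑ j, v j) / (2 ^ (i : ℕ) * n))) ≤ 1 :=
    Real.exp_le_one_iff.2 (neg_nonpos.2 (div_nonneg hs0 (by positivity)))
  set X := Real.exp (-((∑ j, v j) / (2 ^ (i : ℕ) * n)))
  set m := meanSign n v i
  have hτ0 : 0 < 1 / (2 / ε + 1) := by positivity
  have hτ1 : 1 / (2 / ε + 1) < 1 := by rw [div_lt_one (by linarith)]; exact hT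
  rw [div_eq_mul_one_div X]
  set τ := 1 / (2 / ε + 1)
  set t := γ * (1 - τ) / 2 with ht
  set y := 2 * (onesCount z i : ℝ) / n with hy
  have hZ : 2 * (onesCount z i : ℝ) = n * y := by rw [hy]; field_simp
  rw [hZ] at h
  have hfac : (n : ℝ) - n * y - n * (m * τ) = n * (1 - y - m * τ) := by ring
  rw [hfac, abs_mul, abs_of_nonneg (by linarith : (0 : ℝ) ≤ n)] at h
  have h' := abs_lt.1 (lt_of_mul_lt_mul_left h (by linarith))
  have k1 : m * τ ≤ X * τ := mul_le_mul_of_nonneg_right m1 hτ0.le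
  have k2 : (X - 2 / n) * τ ≤ m * τ := mul_le_mul_of_nonneg_right m2 hτ0.le
  have k3 : 2 / (n : ℝ) * τ ≤ 2 / n := mul_le_of_le_one_right (by positivity) hτ1.le
  have k4 : γ * (1 - τ) ≤ γ * (1 - X * τ) := by
    apply mul_le_mul_of_nonneg_left _ hγ0.le
    nlinarith
  constructor <;> nlinarith [h'.1, h'.2]

lemma levels_le_log {u : ℕ} (hu : 1 ≤ u) : (levels u : ℝ) ≤ 2 * Real.log u + 1 := by
  have hu' : (1 : ℝ) ≤ u := by exact_mod_cast hu
  have hl0 : 0 ≤ Real.log u := Real.log_nonneg hu'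
  rcases Nat.eq_or_lt_of_le hu with h | h
  · have : levels u = 0 := by rw [← h]; simp [levels]
    rw [this]
    push_cast
    linarith
  · have hp : 2 ^ (levels u - 1) < u := by
      exact Nat.pow_pred_clog_lt_self (by norm_num) h
    have hp' : (2 : ℝ) ^ (levels u - 1) ≤ u := by exact_mod_cast hp.le
    have h2 := Real.log_le_log (by positivity) hp'
    rw [Real.log_pow] at h2
    have h3 := Real.log_two_gt_d9
    have h4 : (levels u : ℝ) ≤ ((levels u - 1 : ℕ) : ℝ) + 1 := by
      have : levels u ≤ levels u - 1 + 1 := by omega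
      exact_mod_cast this
    have h5 : (0 : ℝ) ≤ ((levels u - 1 : ℕ) : ℝ) := Nat.cast_nonneg _
    nlinarith

/-! ### The choice of the parameters -/

/-- Mean signs of independent bits multiply under addition, and `2 / ε + 1` is the reciprocal of the
mean sign. The merged scale is thus polynomial in `1 / ε`. -/
lemma mergedParam_scale {ε : ℝ} (hε : 0 < ε) :
    2 / mergedParam ε + 1 = (2 * (1 / ε) + 1) ^ 2 := by
  unfold mergedParam
  field_simp
  ring

/-- The reciprocal of the accuracy parameter, as a function of `1 / ε` and `1 / β`. -/
def invAccuracy (a b : ℝ) : ℝ := 16 * Real.exp 3 * (2 * a + 1) ^ 2 * (b + 2)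

/-- A lower bound for the number of buckets, as a function of `1 / ε`, `1 / β` and `log u`. -/
def bucketBound (E a b l : ℝ) : ℝ :=
  8 * (invAccuracy a b * (4 + E) / 2) ^ 2 * (2 * l + 1) + 2 * b +
    2 * (invAccuracy a b * (4 + E) / 2) + 2

lemma exists_polynomial (E : ℝ) : ∃ P : MvPolynomial (Fin 3) ℝ, ∀ a b l : ℝ,
    MvPolynomial.eval ![a, b, l] P = (bucketBound E a b l + 1) * (2 * l + 1) := by
  let Q : MvPolynomial (Fin 3) ℝ := MvPolynomial.C (8 * Real.exp 3 * (4 + E)) *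
    (MvPolynomial.C 2 * MvPolynomial.X 0 + 1) ^ 2 * (MvPolynomial.X 1 + MvPolynomial.C 2)
  refine ⟨(MvPolynomial.C 8 * Q ^ 2 * (MvPolynomial.C 2 * MvPolynomial.X 2 + 1) +
    MvPolynomial.C 2 * MvPolynomial.X 1 + MvPolynomial.C 2 * Q + MvPolynomial.C 2 + 1) *
    (MvPolynomial.C 2 * MvPolynomial.X 2 + 1), fun a b l => ?_⟩
  simp only [Q, map_add, map_mul, map_pow, MvPolynomial.eval_C, MvPolynomial.eval_X, map_one,
    Matrix.cons_val, bucketBound, invAccuracy]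
  ring

/-- With `κ = γ * K`, the tolerance is at most `6 * κ / (1 - 2 * κ) ≤ 16 * κ = β / (1 + 2 * β)`; the
summand `2` next to `1 / β` keeps `κ ≤ 1 / 32` even for large `β`. -/
lemma ratioTolerance_le {ε γ β : ℝ} (hγ0 : 0 < γ) (hβ : 0 < β)
    (hγ : γ * (Real.exp 3 * (2 / ε + 1)) = 1 / (16 * (1 / β + 2))) : ratioTolerance ε γ ≤ β := by
  have hκ : 1 / (16 * (1 / β + 2)) ≤ 1 / 32 :=
    one_div_le_one_div_of_le (by norm_num) (by linarith [show 0 < 1 / β by positivity])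
  have hκβ : 16 * (1 / (16 * (1 / β + 2))) ≤ β := by
    have h : 16 * (1 / (16 * (1 / β + 2))) = β / (1 + 2 * β) := by field_simp
    rw [h]
    exact div_le_self hβ.le (by linarith)
  unfold ratioTolerance
  set K := Real.exp 3 * (2 / ε + 1)
  set κ := 1 / (16 * (1 / β + 2))
  rw [mul_sub, mul_assoc 6, mul_assoc 2, hγ, div_le_iff₀ (by linarith)]
  nlinarith

/-- For large `ε` the noise, and with it the guaranteed frequency of ones, tends to zero. The bound
`ε ≤ E` keeps the allowed absolute deviation at least a constant times `γ`, which is why the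
polynomial depends on `E`. -/
lemma one_sub_scale_ge {ε E : ℝ} (hε : 0 < ε) (hE : ε ≤ E) :
    4 / (4 + E) ≤ 1 - 1 / (2 / mergedParam ε + 1) := by
  have h : 1 - 1 / (2 / mergedParam ε + 1) = 4 * (1 + ε) / (2 + ε) ^ 2 := by
    unfold mergedParam
    field_simp
    ring
  rw [h, div_le_div_iff₀ (by linarith) (by positivity)]
  nlinarith [mul_nonneg hε.le (sub_nonneg.2 hE)]

lemma l1norm_weightVec {u : ℕ} {w : Fin u → ℝ} (hw : ∀ j, 0 < w j ∧ w j ≤ 1)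
    (D : Finset (Fin u)) : l1norm (weightVec w D) = ∑ j, weightVec w D j :=
  Finset.sum_congr rfl fun j _ => abs_of_nonneg (weightVec_mem hw D j).1

lemma sum_weightVec_le {u : ℕ} {w : Fin u → ℝ} (hw : ∀ j, 0 < w j ∧ w j ≤ 1)
    (D : Finset (Fin u)) : ∑ j, weightVec w D j ≤ u := by
  refine (Finset.sum_le_sum fun j _ => (weightVec_mem hw D j).2).trans ?_
  simp

lemma accuracy (E : ℝ) : ∃ P : MvPolynomial (Fin 3) ℝ,
    ∀ (u : ℕ) (ε β : ℝ), 1 ≤ u → 0 < ε → ε ≤ E → 0 < β →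
      ∃ (n : ℕ) (γ : ℝ), 0 < n ∧ 0 < γ ∧
        γ < (β - 1 / n) / (7 * Real.exp 3 * (2 / mergedParam ε + 1)) ∧
        ((n * levels u : ℕ) : ℝ) ≤ MvPolynomial.eval ![1 / ε, 1 / β, Real.log u] P ∧
        ∀ w : Fin u → ℝ, (∀ j, 0 < w j ∧ w j ≤ 1) → ∀ A B : Finset (Fin u),
          1 - 1 / (u : ℝ) ≤ (jointLaw u n ε).real
            {ω | |l1norm (weightVec w (A ∆ B)) -
                estimate (mergedParam ε) γ (mergedSketch w A B ω)| <
              β * l1norm (weightVec w (A ∆ B)) +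
                MvPolynomial.eval ![1 / ε, 1 / β, Real.log u] P} := by
  obtain ⟨P, hP⟩ := exists_polynomial E
  refine ⟨P, fun u ε β hu hε hE hβ => ?_⟩
  rw [hP]
  have hu' : (1 : ℝ) ≤ u := by exact_mod_cast hu
  have hl0 : 0 ≤ Real.log u := Real.log_nonneg hu'
  have hm := mergedParam_pos hε
  have hinv : 0 < invAccuracy (1 / ε) (1 / β) := by unfold invAccuracy; positivity
  have hT := mergedParam_scale hε
  set R := invAccuracy (1 / ε) (1 / β) with hR
  set Q := R * (4 + E) / 2 with hQ
  have hQ0 : 0 < Q := by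
    have : 0 < 4 + E := by linarith
    positivity
  set N := bucketBound E (1 / ε) (1 / β) (Real.log u) with hN
  -- The summands serve, in order, the Chernoff and union bounds, `1 / n ≤ β / 2`, `2 / n ≤ t` for
  -- the deviation `t` with `1 / t ≤ Q`, and `2 ≤ n`.
  have hNval : N = 8 * Q ^ 2 * (2 * Real.log u + 1) + 2 * (1 / β) + 2 * Q + 2 := rfl
  have hb0 : 0 < 1 / β := by positivity
  have hmain : 0 < 8 * Q ^ 2 * (2 * Real.log u + 1) := by positivity
  set n := ⌈N⌉₊ with hn
  have hnN : N ≤ n := Nat.le_ceil N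
  have hnN' : (n : ℝ) < N + 1 := Nat.ceil_lt_add_one (by linarith)
  have hn2' : (2 : ℝ) ≤ n := by linarith
  have hn2 : 2 ≤ n := by exact_mod_cast hn2'
  have hγ0 : 0 < 1 / R := by positivity
  set γ := 1 / R with hγ
  have hγK : γ * (Real.exp 3 * (2 / mergedParam ε + 1)) = 1 / (16 * (1 / β + 2)) := by
    rw [hγ, hR, hT, invAccuracy]
    have : 2 * (1 / ε) + 1 ≠ 0 := by positivity
    have : 1 / β + 2 ≠ 0 := by positivity
    have := Real.exp_ne_zero 3
    generalize 2 * (1 / ε) + 1 = p at *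
    generalize 1 / β + 2 = r at *
    field_simp
  have hκ : 1 / (16 * (1 / β + 2)) ≤ 1 / 32 :=
    one_div_le_one_div_of_le (by norm_num) (by linarith)
  refine ⟨n, γ, by omega, hγ0, ?_, ?_, ?_⟩
  · rw [lt_div_iff₀ (by positivity)]
    have h1 : γ * (7 * Real.exp 3 * (2 / mergedParam ε + 1)) = 7 * (1 / (16 * (1 / β + 2))) := by
      rw [← hγK]; ring
    have h2 : 7 * (1 / (16 * (1 / β + 2))) < β / 2 := by
      have h3 : 7 * (1 / (16 * (1 / β + 2))) = 7 * β / (16 * (1 + 2 * β)) := by field_simp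
      rw [h3, div_lt_div_iff₀ (by positivity) (by norm_num)]
      nlinarith
    have h4 : 1 / (n : ℝ) ≤ β / 2 := by
      have h5 : 2 * (1 / β) ≤ n := by linarith
      have h6 : 1 / (n : ℝ) ≤ 1 / (2 * (1 / β)) := one_div_le_one_div_of_le (by positivity) h5
      have h7 : 1 / (2 * (1 / β)) = β / 2 := by field_simp
      linarith
    linarith
  · push_cast
    exact mul_le_mul hnN'.le (levels_le_log hu) (Nat.cast_nonneg _) (by linarith)
  · intro w hw A B
    -- For `u = 1` there are no levels, but the required probability is `0`.
    rcases Nat.eq_or_lt_of_le hu with h | h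
    · have h1 : 1 - 1 / (u : ℝ) = 0 := by simp [← h]
      rw [h1]
      exact measureReal_nonneg
    set τ := 1 / (2 / mergedParam ε + 1) with hτ
    have hτ' := one_sub_scale_ge hε hE
    rw [← hτ] at hτ'
    have h4E : 0 < 4 / (4 + E) := div_pos (by norm_num) (by linarith)
    have hτ0 : 0 < τ := by positivity
    set t := γ * (1 - τ) / 2 with ht
    have ht0 : 0 < t := by
      have : 0 < 1 - τ := by linarith
      positivity
    have hγ1 : γ ≤ 1 := by
      have h1 : 1 ≤ Real.exp 3 * (2 / mergedParam ε + 1) := by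
        have h2 := Real.one_le_exp (show (0 : ℝ) ≤ 3 by norm_num)
        have h3 : 0 ≤ 2 / mergedParam ε := by positivity
        nlinarith
      nlinarith
    have ht2 : t ≤ 2 := by
      rw [ht]
      nlinarith
    have htQ : 1 / t ≤ Q := by
      have h1 : γ * (4 / (4 + E)) / 2 ≤ t := by
        rw [ht]; gcongr
      have h2 : 1 / t ≤ 1 / (γ * (4 / (4 + E)) / 2) :=
        one_div_le_one_div_of_le (by positivity) h1
      have h3 : 1 / (γ * (4 / (4 + E)) / 2) = Q := by
        have : 4 + E ≠ 0 := by linarith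
        rw [hγ, hQ]
        field_simp
        norm_num
      linarith
    have hnt : 8 * (1 / t) ^ 2 * (2 * Real.log u + 1) ≤ n := by
      have h1 : 8 * (1 / t) ^ 2 * (2 * Real.log u + 1) ≤ 8 * Q ^ 2 * (2 * Real.log u + 1) := by
        gcongr
      linarith
    have hnt2 : 2 / (n : ℝ) ≤ t := by
      rw [div_le_iff₀ (by linarith)]
      have h1 : 2 * (1 / t) ≤ n := by linarith
      have h2 := mul_le_mul_of_nonneg_left h1 ht0.le
      have h3 : t * (2 * (1 / t)) = 2 := by field_simp
      linarith
    have := isProbabilityMeasure_hashLaw u n (by omega)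
    have := isProbabilityMeasure_noiseLaw u n hε
    refine (all_levels_close hu hn2 hε ht0 ht2 hnt hw A B).trans
      (measureReal_mono fun ω hω => ?_)
    have hclose := isClose_of_concentrated hn2 hm hγ0 (weightVec_mem hw (A ∆ B)) hnt2 hω
    have hsum0 : 0 ≤ ∑ j, weightVec w (A ∆ B) j :=
      Finset.sum_nonneg fun j _ => (weightVec_mem hw _ j).1
    have herr := estimate_error h hn2 hm hγ0 (by rw [hγK]; linarith) hsum0
      (sum_weightVec_le hw (A ∆ B)) hclose
    rw [Set.mem_ofPred_eq, l1norm_weightVec hw]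
    have hη := mul_le_mul_of_nonneg_right (ratioTolerance_le hγ0 hβ hγK) hsum0
    have hβW := mul_nonneg hβ.le hsum0
    -- The polynomial bounding the sketch size also exceeds `n`, so it absorbs the additive error of
    -- a rejected estimate.
    have hpoly : N + 1 ≤ (N + 1) * (2 * Real.log u + 1) :=
      le_mul_of_one_le_right (by linarith) (by linarith)
    rcases herr with herr | herr <;> linarith

end KOR

end

theorem corollary2 :
    -- For every choice of `h` and `s`, the noisy sketch is `ε`-differentially private.
    (∀ (u n : ℕ) (w : Fin u → ℝ) (ε : ℝ), (∀ j, 0 < w j ∧ w j ≤ 1) → 0 < ε →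
      ∀ (h : Fin u → Fin n) (s : Fin u → unitInterval),
        KOR.DifferentiallyPrivate ε (KOR.noisySketchLaw w h s ε)) ∧
    -- The sum of two noisy sketches is a noisy sketch of the symmetric difference, ...
    (∀ (u n : ℕ) (w : Fin u → ℝ) (h : Fin u → Fin n) (s : Fin u → unitInterval)
      (A B : Finset (Fin u)) (φ ψ : KOR.Sketch u n),
        KOR.noisySketch w h s A φ + KOR.noisySketch w h s B ψ =
          KOR.noisySketch w h s (A ∆ B) (φ + ψ)) ∧
    -- ... with noise of privacy parameter `ε ^ 2 / (2 + 2 * ε)`.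
    (∀ (u n : ℕ) (ε : ℝ), 0 < ε →
      ((KOR.noiseLaw u n ε).prod (KOR.noiseLaw u n ε)).map (fun φψ => φψ.1 + φψ.2) =
        KOR.noiseLaw u n (KOR.mergedParam ε)) ∧
    -- Accuracy of the estimate that is computed from the sum.
    (∀ E : ℝ, ∃ P : MvPolynomial (Fin 3) ℝ,
      ∀ (u : ℕ) (ε β : ℝ), 1 ≤ u → 0 < ε → ε ≤ E → 0 < β →
        ∃ (n : ℕ) (γ : ℝ), 0 < n ∧ 0 < γ ∧
          γ < (β - 1 / n) / (7 * Real.exp 3 * (2 / KOR.mergedParam ε + 1)) ∧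
          ((n * KOR.levels u : ℕ) : ℝ) ≤
            MvPolynomial.eval ![1 / ε, 1 / β, Real.log u] P ∧
          ∀ w : Fin u → ℝ, (∀ j, 0 < w j ∧ w j ≤ 1) → ∀ A B : Finset (Fin u),
            1 - 1 / (u : ℝ) ≤
              ((KOR.hashLaw u n).prod
                ((KOR.noiseLaw u n ε).prod (KOR.noiseLaw u n ε))).real
                {ω | |KOR.l1norm (KOR.weightVec w (A ∆ B)) -
                      KOR.estimate (KOR.mergedParam ε) γ
                        (KOR.noisySketch w ω.1.1 ω.1.2 A ω.2.1 +
                          KOR.noisySketch w ω.1.1 ω.1.2 B ω.2.2)| <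
                    β * KOR.l1norm (KOR.weightVec w (A ∆ B)) +
                      MvPolynomial.eval ![1 / ε, 1 / β, Real.log u] P}) := by
  refine ⟨fun u n w ε hw hε h s =>
      KOR.differentiallyPrivate_noisySketchLaw (fun j => (hw j).1) hε h s,
    fun u n w h s A B φ ψ => KOR.noisySketch_add w h s A B φ ψ,
    fun u n ε hε => KOR.map_add_noiseLaw u n hε, KOR.accuracy⟩
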